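/- Conventions. Real random variables $X_1,\dots,X_n$ ($n\ge 1$) are exchangeable if their joint law is invariant under permutations of the sequence. A (randomized) stopping rule is a family of measurable functions $r_i$, $i=1,\dots,n$, with values in $[0,1]$, where $r_i(x_1,\dots,x_i)$ is the probability of stopping at step $i$ when $x_1,\dots,x_i$ have been observed and the rule has not stopped before. Its stopping time $\tau$ takes values in $\{1,\dots,n\}\cup\{\infty\}$ and satisfies $$\mathbb P(\tau=i\mid X_1,\dots,X_n)=\Bigl(\prod_{j<i}\bigl(1-r_j(X_1,\dots,X_j)\bigr)\Bigr)\,r_i(X_1,\dots,X_i)\qquad(1\le i\le n).$$ Put $X_\infty=0$. The stopping rule may depend on the joint law of the sequence. Theorem. (1) For every $\delta>0$ there is $n_0\in\mathbb N$ such that for every $n\ge n_0$ there are exchangeable random variables $X_1,\dots,X_n$ with values in $[0,1]$ and $\mathbb E[\max_i X_i]>0$ such that every stopping rule, with stopping time $\tau$, satisfies $$\mathbb E[X_\tau]\le\Bigl(\frac1e+\delta\Bigr)\,\mathbb E\bigl[\max\{X_1,\dots,X_n\}\bigr].$$ (2) The largest real constant $\gamma$ with the property that, for every $n\ge1$ and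 all exchangeable random variables $X_1,\dots,X_n$ with values in $[0,1]$, some stopping rule with stopping time $\tau$ satisfies $\mathbb E[X_\tau]\ge\gamma\,\mathbb E[\max\{X_1,\dots,X_n\}]$, is $\gamma=1/e$. The same holds with "non-negative and integrable" in place of "with values in $[0,1]$". -/

import Mathlib

open MeasureTheory ProbabilityTheory

universe u

namespace Prophet

/-- Real random variables `X 1, …, X n` are exchangeable if their joint law is invariant under
permutations of the sequence. -/
def Exchangeable {n : ℕ} {Ω : Type u} [MeasurableSpace Ω] (X : Fin n → Ω → ℝ) (P : Measure Ω) :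
    Prop :=
  ∀ σ : Equiv.Perm (Fin n),
    P.map (fun ω (i : Fin n) => X (σ i) ω) = P.map (fun ω (i : Fin n) => X i ω)

/-- A (randomized) stopping rule for a sequence of length `n`: `prob i x` is the probability of
stopping at step `i`, given that the values `x` have been observed at the steps `j ≤ i` and that
the rule has not stopped before. -/
structure StoppingRule (n : ℕ) where
  prob : (i : Fin n) → (Set.Iic i → ℝ) → ℝ
  measurable_prob : ∀ i, Measurable (prob i)
  prob_mem : ∀ i x, prob i x ∈ Set.Icc (0 : ℝ) 1

/-- The probability that the rule stops exactly at step `i` when the whole sequence is `x`. -/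
noncomputable def StoppingRule.stopProb {n : ℕ} (r : StoppingRule n) (i : Fin n)
    (x : Fin n → ℝ) : ℝ :=
  (∏ j ∈ Finset.Iio i, (1 - r.prob j (fun k => x k))) * r.prob i (fun k => x k)

/-- `τ` (with values in `{1, …, n} ∪ {∞}`) is a stopping time of the stopping rule `r` on the
sequence `X`: it is a random variable, and conditionally on the whole sequence it equals `i` with
the probability prescribed by `r`. -/
def IsStoppingTimeOf {n : ℕ} {Ω : Type u} [MeasurableSpace Ω] (r : StoppingRule n)
    (X : Fin n → Ω → ℝ) (τ : Ω → WithTop (Fin n)) (P : Measure Ω) : Prop :=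
  ∀ i : Fin n, MeasurableSet {ω | τ ω = (i : WithTop (Fin n))} ∧
    P⟦{ω | τ ω = (i : WithTop (Fin n))} |
        MeasurableSpace.comap (fun ω (j : Fin n) => X j ω) inferInstance⟧
      =ᵐ[P] fun ω => r.stopProb i (fun j => X j ω)

/-- The value `X_τ`, with the convention `X_∞ = 0`. -/
def stopped {n : ℕ} {Ω : Type u} (X : Fin n → Ω → ℝ) (τ : Ω → WithTop (Fin n)) (ω : Ω) : ℝ :=
  WithTop.recTopCoe (C := fun _ => ℝ) 0 (fun i => X i ω) (τ ω)

/-- `γ` is a universal constant for exchangeable sequences with values in `S`: for every `n ≥ 1`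
and every such integrable sequence of length `n`, some stopping rule has a stopping time `τ` with
`E[X_τ] ≥ γ E[max X_i]`. -/
def IsUniversalConstant (S : Set ℝ) (γ : ℝ) : Prop :=
  ∀ (n : ℕ), 1 ≤ n → ∀ (Ω : Type u) [MeasurableSpace Ω] (P : Measure Ω) [IsProbabilityMeasure P]
    (X : Fin n → Ω → ℝ), (∀ i, Measurable (X i)) → (∀ i, Integrable (X i) P) →
    (∀ᵐ ω ∂P, ∀ i, X i ω ∈ S) → Exchangeable X P →
    ∃ (r : StoppingRule n) (τ : Ω → WithTop (Fin n)), IsStoppingTimeOf r X τ P ∧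
      γ * ∫ ω, (⨆ i, X i ω) ∂P ≤ ∫ ω, stopped X τ ω ∂P

end Prophet

/-! Both bounds reduce to the secretary problem, whose optimal winning probability tends to `1/e`.

Upper bound. Take `n ≤ t < K` with probability proportional to `1/(t+1)`, and sample `n` numbers
without replacement from `{0, …, t-1}`. Under this nearly scale-free prior, the values seen so far
say almost nothing about whether the next one is a record: after `i` observations a record comes
with probability close to `1/(i+1)`. For the unnormalized mixture, whose mass `totalWeight n K` is
unbounded in `K`, the error is at most 2, because the sums over `t` telescope to boundary terms
(`abs_record_defect_le`, `abs_sum_record_sub_le`). Rules that see the values are therefore hardly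
better than rules that see relative ranks. A dual solution of the secretary linear program turns
this into a potential argument: `(i/n) * (mass stopped at the current leader) + dualValue n i *
(mass not stopped)` grows by at most 4 per step (`sum_seqWeight_lead_le`). To pass from winning to
rewards, replace `a` by `ε ^ (K - a)`, so that every value but the maximum is at most `ε` times the
maximum, and reweight each sequence by the inverse of its maximum. Under the new law the ratio of
expected reward to expected maximum is the mixture average of reward over maximum, that is, the
winning probability up to `ε` (`exists_hard_law`).

Lower bound. Conditionally on the multiset of values, an exchangeable sequence is in uniformly
random order. The classical rule with cutoff `r` therefore picks a maximum with probability at least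
`(r/n) ∑_{r ≤ k < n} 1/k`, and for each `n ≥ 2` some `r` makes this at least `1/e`
(`exists_cutoff`). Ties are broken by a permutation; averaging over all of them leaves a fixed one
that is good enough (`exists_cutoffRule_reward`). -/

namespace Prophet

/-! ### Harmonic sums and the secretary cutoff -/

/-- The partial harmonic sum `∑_{k ≤ j < n} 1 / j`. -/
noncomputable def harmonicTail (n k : ℕ) : ℝ := ∑ j ∈ Finset.Ico k n, (1 / (j : ℝ))

theorem harmonicTail_self (n : ℕ) : harmonicTail n n = 0 := by simp [harmonicTail]

theorem harmonicTail_succ {n k : ℕ} (h : k < n) :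
    harmonicTail n k = 1 / k + harmonicTail n (k + 1) := by
  simp only [harmonicTail]
  rw [Finset.sum_eq_sum_Ico_succ_bot h]

theorem harmonicTail_nonneg (n k : ℕ) : 0 ≤ harmonicTail n k :=
  Finset.sum_nonneg fun _ _ => by positivity

theorem harmonicTail_le_of_succ {n k : ℕ} (h : k < n) :
    harmonicTail n (k + 1) ≤ harmonicTail n k := by
  rw [harmonicTail_succ h]
  have : (0 : ℝ) ≤ 1 / k := by positivity
  linarith

/-- Trapezoidal estimate for the logarithm on a unit interval. -/
theorem log_succ_sub_log_le {k : ℕ} (hk : 1 ≤ k) :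
    Real.log (k + 1) - Real.log k ≤ (1 / (k : ℝ) + 1 / (k + 1)) / 2 := by
  have hk' : (0 : ℝ) < k := by exact_mod_cast hk
  rw [← Real.log_div (by positivity) (by positivity)]
  have h1 : ((k : ℝ) + 1) / k = 1 + 1 / k := by field_simp
  rw [h1]
  set s : ℝ := 1 / k with hs
  have hs0 : 0 < s := by positivity
  have h2 : 1 / ((k : ℝ) + 1) = s / (1 + s) := by rw [hs]; field_simp
  rw [h2]
  -- With `s = 1/k`, the trapezoid minus the logarithm vanishes at 0 and has derivative `x² /
  -- (2(1+x)²)`.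
  have mono : MonotoneOn (fun t : ℝ => (t + t / (1 + t)) / 2 - Real.log (1 + t)) (Set.Ici 0) := by
    apply monotoneOn_of_deriv_nonneg (convex_Ici 0)
    · apply ContinuousOn.sub
      · apply ContinuousOn.div_const
        apply ContinuousOn.add continuousOn_id
        apply ContinuousOn.div continuousOn_id (by fun_prop)
        intro x hx
        have : (0 : ℝ) ≤ x := hx
        positivity
      · apply ContinuousOn.log (by fun_prop)
        intro x hx
        have : (0 : ℝ) ≤ x := hx
        positivity
    · intro x hx
      rw [interior_Ici] at hx
      have hx0 : (0 : ℝ) < x := hx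
      have hx1 : 1 + x ≠ 0 := by positivity
      have : DifferentiableAt ℝ (fun t : ℝ => (t + t / (1 + t)) / 2 - Real.log (1 + t)) x := by
        fun_prop (disch := assumption)
      exact this.differentiableWithinAt
    · intro x hx
      rw [interior_Ici] at hx
      have hx0 : (0 : ℝ) < x := hx
      have hx1 : 1 + x ≠ 0 := by positivity
      have hd : HasDerivAt (fun t : ℝ => (t + t / (1 + t)) / 2 - Real.log (1 + t))
          ((1 + (1 * (1 + x) - x * 1) / (1 + x) ^ 2) / 2 - 1 / (1 + x)) x := by
        have ha : HasDerivAt (fun t : ℝ => 1 + t) 1 x := (hasDerivAt_id x).const_add 1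
        exact (((hasDerivAt_id x).add ((hasDerivAt_id x).div ha hx1)).div_const 2).sub
          (ha.log hx1)
      rw [hd.deriv]
      have : (1 + (1 * (1 + x) - x * 1) / (1 + x) ^ 2) / 2 - 1 / (1 + x)
          = x ^ 2 / (2 * (1 + x) ^ 2) := by field_simp; ring
      rw [this]; positivity
  have := mono (Set.mem_Ici.2 le_rfl) (Set.mem_Ici.2 hs0.le) hs0.le
  simp at this
  linarith

/-- The trapezoidal estimates telescope. The endpoint correction `(1/r - 1/n)/2` is what yields
`1/e` exactly for every `n ≥ 2`, not only in the limit. -/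
theorem log_div_add_le_harmonicTail {n r : ℕ} (hr : 1 ≤ r) (hrn : r ≤ n) :
    Real.log (n / r) + (1 / (r : ℝ) - 1 / n) / 2 ≤ harmonicTail n r := by
  have hr0 : (0 : ℝ) < r := by exact_mod_cast hr
  induction n, hrn using Nat.le_induction with
  | base => simp [harmonicTail_self, div_self hr0.ne']
  | succ m hm ih =>
    have hm0 : (0 : ℝ) < m := by exact_mod_cast hr.trans hm
    have h1 : harmonicTail (m + 1) r = harmonicTail m r + 1 / m := by
      simp only [harmonicTail]
      rw [Finset.sum_Ico_succ_top hm]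
    have h2 := log_succ_sub_log_le (hr.trans hm)
    rw [h1]
    rw [Real.log_div (by positivity) (by positivity)] at ih ⊢
    push_cast
    linarith

theorem harmonicTail_le {n r : ℕ} (hr : 1 ≤ r) (hrn : r ≤ n) :
    harmonicTail n r ≤ 1 / r + Real.log (n / r) := by
  have hr0 : (0 : ℝ) < r := by exact_mod_cast hr
  suffices h : harmonicTail n r + 1 / n ≤ 1 / r + Real.log (n / r) by
    have : (0 : ℝ) ≤ 1 / n := by positivity
    linarith
  induction n, hrn using Nat.le_induction with
  | base => simp [harmonicTail_self, div_self hr0.ne']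
  | succ m hm ih =>
    have hm0 : (0 : ℝ) < m := by exact_mod_cast hr.trans hm
    have h1 : harmonicTail (m + 1) r = harmonicTail m r + 1 / m := by
      simp only [harmonicTail]
      rw [Finset.sum_Ico_succ_top hm]
    have h2 : 1 / ((m : ℝ) + 1) ≤ Real.log (m + 1) - Real.log m := by
      have := Real.one_sub_inv_le_log_of_pos (x := ((m : ℝ) + 1) / m) (by positivity)
      rw [Real.log_div (by positivity) (by positivity)] at this
      refine le_trans (le_of_eq ?_) this
      field_simp
      ring
    rw [h1]
    rw [Real.log_div (by positivity) (by positivity)] at ih ⊢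
    push_cast
    linarith

theorem mul_log_inv_le {t : ℝ} (ht : 0 < t) : t * Real.log (1 / t) ≤ 1 / Real.exp 1 := by
  have he := Real.exp_pos 1
  have h := Real.log_le_sub_one_of_pos (x := 1 / (t * Real.exp 1)) (by positivity)
  have h2 : Real.log (1 / (t * Real.exp 1)) = Real.log (1 / t) - 1 := by
    rw [one_div, mul_inv, Real.log_mul (by positivity) (by positivity), Real.log_inv (Real.exp 1),
      Real.log_exp, one_div]
    ring
  rw [h2] at h
  have h3 : Real.log (1 / t) ≤ 1 / (t * Real.exp 1) := by linarith
  calc t * Real.log (1 / t) ≤ t * (1 / (t * Real.exp 1)) := by gcongr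
    _ = 1 / Real.exp 1 := by field_simp

theorem mul_harmonicTail_le {n r : ℕ} (hr : 1 ≤ r) (hrn : r ≤ n) :
    (r / n : ℝ) * harmonicTail n r ≤ 1 / Real.exp 1 + 1 / n := by
  have hr0 : (0 : ℝ) < r := by exact_mod_cast hr
  have hn0 : (0 : ℝ) < n := by exact_mod_cast hr.trans hrn
  have h1 := harmonicTail_le hr hrn
  have h2 := mul_log_inv_le (t := (r : ℝ) / n) (by positivity)
  rw [one_div_div] at h2
  calc (r / n : ℝ) * harmonicTail n r ≤ (r / n : ℝ) * (1 / r + Real.log (n / r)) := by gcongr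
    _ = (r / n : ℝ) * Real.log (n / r) + 1 / n := by field_simp; ring
    _ ≤ _ := by linarith

/-- In the secretary problem with `n ≥ 2` candidates, some cutoff wins with probability at least
`1 / e`. -/
theorem exists_cutoff {n : ℕ} (hn : 2 ≤ n) : ∃ r : ℕ, 1 ≤ r ∧ r < n ∧
    1 / Real.exp 1 ≤ (r / n : ℝ) * harmonicTail n r := by
  have he1 : (2.7182818283 : ℝ) < Real.exp 1 := Real.exp_one_gt_d9
  have he2 : Real.exp 1 < 2.7182818286 := Real.exp_one_lt_d9
  have he := Real.exp_pos 1
  rcases hn.eq_or_lt with rfl | hn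
  · refine ⟨1, le_rfl, by norm_num, ?_⟩
    have : harmonicTail 2 1 = 1 := by simp [harmonicTail]
    rw [this, div_le_iff₀ he]
    norm_num
    linarith
  have hn3 : (3 : ℝ) ≤ n := by exact_mod_cast hn
  set c : ℝ := n / Real.exp 1 with hc
  have hc0 : 0 < c := by positivity
  have hce : c * Real.exp 1 = n := by rw [hc]; field_simp
  have hc1 : 1.1 < c := by
    rw [hc, lt_div_iff₀ he]; nlinarith
  -- The cutoff is `n/e` rounded to a nearest integer.
  obtain ⟨r, hr1, hr2⟩ : ∃ r : ℕ, c - 1 / 2 ≤ r ∧ (r : ℝ) ≤ c + 1 / 2 := by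
    refine ⟨⌊c + 1 / 2⌋₊, ?_, Nat.floor_le (by positivity)⟩
    have := Nat.lt_floor_add_one (c + 1 / 2)
    linarith
  have hr0 : (0 : ℝ) < r := by linarith
  have hn0 : (0 : ℝ) < n := by linarith
  have hrn : (r : ℝ) < n := by nlinarith
  refine ⟨r, by exact_mod_cast hr0, by exact_mod_cast hrn, ?_⟩
  have hr1' : 1 ≤ r := by exact_mod_cast hr0
  have hrn' : r ≤ n := by exact_mod_cast hrn.le
  have h1 := log_div_add_le_harmonicTail hr1' hrn'
  have h2 := Real.log_le_sub_one_of_pos (x := (r : ℝ) / c) (by positivity)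
  have h3 : Real.log (n / r) = 1 - Real.log (r / c) := by
    rw [← hce, Real.log_div (by positivity) (by positivity),
      Real.log_div (by positivity) (by positivity), Real.log_mul (by positivity) (by positivity),
      Real.log_exp]
    ring
  have h4 : 2 - r / c + (1 / (r : ℝ) - 1 / n) / 2 ≤ harmonicTail n r := by linarith
  refine le_trans ?_ (mul_le_mul_of_nonneg_left h4 (by positivity))
  have h5 : 1 / Real.exp 1 = c / n := by rw [hc]; field_simp
  have h6 : (r / n : ℝ) * (2 - r / c + (1 / (r : ℝ) - 1 / n) / 2)
      = (2 * r - r ^ 2 / c + (1 - r / n) / 2) / n := by field_simp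
  rw [h5, h6]
  apply div_le_div_of_nonneg_right _ hn0.le
  -- After multiplication by `n`, rounding costs `(r-c)²/c ≤ 1/(4c)`, while the trapezoidal
  -- correction gains `(1 - r/n)/2`. For `n ≥ 3` the loss is below 0.228 and the gain above 0.231.
  have h7 : 2 * r - r ^ 2 / c = c - (r - c) ^ 2 / c := by field_simp; ring
  rw [h7]
  have h8 : (r - c) ^ 2 / c ≤ 1 / (4 * c) := by
    rw [div_le_div_iff₀ hc0 (by positivity)]
    have : (r - c) ^ 2 ≤ 1 / 4 := by nlinarith
    nlinarith
  have h9 : (r : ℝ) / n ≤ 1 / Real.exp 1 + 1 / (2 * n) := by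
    rw [h5]
    rw [show c / n + 1 / (2 * n) = (c + 1 / 2) / n by field_simp]
    gcongr
  have h10 : 1 / (2 * (n : ℝ)) ≤ 1 / 6 := by
    rw [div_le_div_iff₀ (by positivity) (by norm_num)]; linarith
  have h11 : 1 / Real.exp 1 ≤ 0.37 := by
    rw [div_le_iff₀ he]; nlinarith
  have h12 : 1 / (4 * c) ≤ 1 / 4.4 := by
    apply one_div_le_one_div_of_le (by norm_num); linarith
  norm_num at *
  linarith

/-! ### The dual solution of the secretary problem -/

/-- A dual solution of the linear program of the secretary problem: an upper bound for the
probability to win when the first `i` candidates have been rejected. -/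
noncomputable def dualValue (n i : ℕ) : ℝ :=
  ∑ k ∈ Finset.Ico (i + 1) (n + 1), (1 / (n : ℝ)) * max (1 - harmonicTail n k) 0

theorem dualValue_self (n : ℕ) : dualValue n n = 0 := by simp [dualValue]

theorem dualValue_nonneg (n i : ℕ) : 0 ≤ dualValue n i :=
  Finset.sum_nonneg fun _ _ => by positivity

theorem dualValue_eq {n i : ℕ} (h : i < n) : dualValue n i =
    dualValue n (i + 1) + (1 / (n : ℝ)) * max (1 - harmonicTail n (i + 1)) 0 := by
  simp only [dualValue]
  rw [Finset.sum_eq_sum_Ico_succ_bot (by omega), add_comm]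

theorem dualValue_succ_le {n i : ℕ} (h : i < n) : dualValue n (i + 1) ≤ dualValue n i := by
  rw [dualValue_eq h]
  have : 0 ≤ (1 / (n : ℝ)) * max (1 - harmonicTail n (i + 1)) 0 := by positivity
  linarith

/-- Backward induction: with `m = min (H_{k+1}) 1`, the identity `(k/n)(1/k + m) = ((k+1)/n) m +
(1-m)/n` matches the increment of `dualValue`. This is the estimate behind dual feasibility. -/
theorem min_le_dualValue {n : ℕ} (i : ℕ) (hi : 1 ≤ i) (hin : i ≤ n) :
    (i / n : ℝ) * min (harmonicTail n i) 1 ≤ dualValue n i := by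
  induction hin using Nat.decreasingInduction with
  | self => simp [harmonicTail_self, dualValue_self]
  | of_succ k hk ih =>
    have hk0 : (0 : ℝ) < k := by exact_mod_cast hi
    have hn0 : (0 : ℝ) < n := by exact_mod_cast (by omega : 0 < n)
    have ih := ih (by omega)
    rw [dualValue_eq hk]
    have h1 : min (harmonicTail n k) 1 ≤ 1 / k + min (harmonicTail n (k + 1)) 1 := by
      rw [harmonicTail_succ hk]
      have : (0 : ℝ) ≤ 1 / k := by positivity
      rcases le_total (harmonicTail n (k + 1)) 1 with h | h
      · rw [min_eq_left h]; exact min_le_left _ _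
      · rw [min_eq_right h]; exact (min_le_right _ _).trans (by linarith)
    have h2 : max (1 - harmonicTail n (k + 1)) 0 = 1 - min (harmonicTail n (k + 1)) 1 := by
      rcases le_total (harmonicTail n (k + 1)) 1 with h | h
      · rw [min_eq_left h, max_eq_left (by linarith)]
      · rw [min_eq_right h, max_eq_right (by linarith)]; ring
    rw [h2]
    set m := min (harmonicTail n (k + 1)) 1
    push_cast at ih
    calc (k / n : ℝ) * min (harmonicTail n k) 1 ≤ (k / n : ℝ) * (1 / k + m) := by gcongr
      _ = ((k + 1) / n : ℝ) * m + 1 / n * (1 - m) := by field_simp; ring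
      _ ≤ _ := by linarith

/-- Dual feasibility against the option of stopping at a record: at index `i` a record comes with
probability `1/(i+1)`, and stopping there wins with probability `(i+1)/n`, which contributes `1/n`.
The option of rejecting is covered by `dualValue_succ_le`. -/
theorem mul_dualValue_add_le {n i : ℕ} (h : i < n) :
    (i / (i + 1) : ℝ) * dualValue n (i + 1) + 1 / n ≤ dualValue n i := by
  have hn0 : (0 : ℝ) < n := by exact_mod_cast (by omega : 0 < n)
  have h1 := min_le_dualValue (n := n) (i + 1) (by omega) h
  rw [dualValue_eq h]
  have h2 : 1 - min (harmonicTail n (i + 1)) 1 ≤ max (1 - harmonicTail n (i + 1)) 0 := by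
    rcases le_total (harmonicTail n (i + 1)) 1 with h | h
    · rw [min_eq_left h, max_eq_left (by linarith)]
    · rw [min_eq_right h, max_eq_right (by linarith)]; linarith
  set m := min (harmonicTail n (i + 1)) 1
  set v := dualValue n (i + 1)
  push_cast at h1
  have h3 : m / n ≤ v / (i + 1) := by
    rw [le_div_iff₀ (by positivity)]
    refine le_trans (le_of_eq ?_) h1
    ring
  have h4 : (i / (i + 1) : ℝ) * v = v - v / (i + 1) := by field_simp; ring
  have h5 : 1 / (n : ℝ) * (1 - m) ≤ 1 / n * max (1 - harmonicTail n (i + 1)) 0 := by gcongr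
  have h6 : 1 / (n : ℝ) * (1 - m) = 1 / n - m / n := by ring
  linarith

theorem dualValue_eq_of_le_one {n : ℕ} (i : ℕ) (hi : 1 ≤ i) (hin : i ≤ n)
    (h : harmonicTail n (i + 1) ≤ 1) : dualValue n i = (i / n : ℝ) * harmonicTail n i := by
  induction hin using Nat.decreasingInduction with
  | self => simp [harmonicTail_self, dualValue_self]
  | of_succ k hk ih =>
    have hk0 : (0 : ℝ) < k := by exact_mod_cast hi
    have hn0 : (0 : ℝ) < n := by exact_mod_cast (by omega : 0 < n)
    rw [dualValue_eq hk, harmonicTail_succ hk, max_eq_left (by linarith)]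
    have h1 : harmonicTail n (k + 1 + 1) ≤ 1 := by
      rcases Nat.lt_or_ge (k + 1) n with h2 | h2
      · exact (harmonicTail_le_of_succ h2).trans h
      · simp [harmonicTail, Finset.Ico_eq_empty_of_le (by omega : n ≤ k + 1 + 1)]
    rw [ih (by omega) h1]
    push_cast
    field_simp
    ring

/-- Going down in `i`, the dual value grows only while the harmonic tail after `i` is below 1. There
it equals `(i/n) H_i`, the success probability of cutoff `i`; below that range it is frozen. -/
theorem dualValue_zero_le {n : ℕ} (hn : 3 ≤ n) : dualValue n 0 ≤ 1 / Real.exp 1 + 1 / n := by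
  have key : ∀ i, 1 ≤ i → i ≤ n → dualValue n i ≤ 1 / Real.exp 1 + 1 / n := by
    intro i hi hin
    induction hin using Nat.decreasingInduction with
    | self => rw [dualValue_self]; positivity
    | of_succ k hk ih =>
      rcases le_total (harmonicTail n (k + 1)) 1 with h | h
      · rw [dualValue_eq_of_le_one k hi hk.le h]
        exact mul_harmonicTail_le hi hk.le
      · rw [dualValue_eq hk, max_eq_right (by linarith)]
        simpa using ih (by omega)
  have h1 : 1 ≤ harmonicTail n 1 := by
    rw [harmonicTail_succ (by omega)]
    have := harmonicTail_nonneg n (1 + 1)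
    simp
    linarith
  rw [dualValue_eq (by omega), max_eq_right (by simpa using h1)]
  simpa using key 1 le_rfl (by omega)

/-! ### Sampling without replacement -/

section Weights

variable {K : ℕ}

/-- One more than the largest value of `y`. -/
def height {m : ℕ} (y : Fin m → Fin K) : ℕ := Finset.univ.sup fun j => (y j : ℕ) + 1

theorem height_le_iff {m : ℕ} (y : Fin m → Fin K) (t : ℕ) :
    height y ≤ t ↔ ∀ j, (y j : ℕ) < t := by
  simp [height]

theorem height_le {m : ℕ} (y : Fin m → Fin K) : height y ≤ K :=
  (height_le_iff y K).2 fun j => (y j).2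

theorem card_le_height {m : ℕ} {y : Fin m → Fin K} (hy : Function.Injective y) :
    m ≤ height y := by
  have h := Finset.card_le_card_of_injOn (s := (Finset.univ : Finset (Fin m)))
    (t := Finset.range (height y)) (fun j => (y j : ℕ))
    (fun j _ => by
      simpa using (height_le_iff y (height y)).1 le_rfl j)
    (fun a _ b _ hab => hy (Fin.ext hab))
  simpa using h

open Classical in
/-- The probability of the sequence `y` in sampling without replacement from `{0, …, t - 1}`. -/
noncomputable def sampleProb (t : ℕ) {m : ℕ} (y : Fin m → Fin K) : ℝ :=
  if Function.Injective y ∧ height y ≤ t then 1 / (t.descFactorial m : ℝ) else 0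

theorem sampleProb_nonneg (t : ℕ) {m : ℕ} (y : Fin m → Fin K) : 0 ≤ sampleProb t y := by
  unfold sampleProb; split_ifs <;> positivity

theorem descFactorial_cast_pos {t m : ℕ} (h : m ≤ t) : (0 : ℝ) < t.descFactorial m := by
  exact_mod_cast Nat.descFactorial_pos.2 h

theorem descFactorial_cast_succ {t m : ℕ} (h : m ≤ t) :
    (t.descFactorial (m + 1) : ℝ) = (t - m) * t.descFactorial m := by
  rw [Nat.descFactorial_succ]; push_cast [Nat.cast_sub h]; ring

theorem snoc_injective_iff {m : ℕ} (y : Fin m → Fin K) (a : Fin K) :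
    Function.Injective (Fin.snoc y a : Fin (m + 1) → Fin K) ↔
      Function.Injective y ∧ a ∉ Set.range y := by
  exact Fin.snoc_injective_iff

theorem height_snoc_le_iff {m : ℕ} (y : Fin m → Fin K) (a : Fin K) (t : ℕ) :
    height (Fin.snoc y a : Fin (m + 1) → Fin K) ≤ t ↔ height y ≤ t ∧ (a : ℕ) < t := by
  simp only [height_le_iff, Fin.forall_fin_succ', Fin.snoc_castSucc, Fin.snoc_last]

open Classical in
theorem sum_sampleProb_snoc {t m : ℕ} (hmt : m < t) (htK : t ≤ K) (y : Fin m → Fin K) :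
    ∑ a, sampleProb t (Fin.snoc y a : Fin (m + 1) → Fin K) = sampleProb t y := by
  unfold sampleProb
  simp only [snoc_injective_iff, height_snoc_le_iff]
  by_cases h : Function.Injective y ∧ height y ≤ t
  · rw [if_pos h]
    have h1 : ∀ a : Fin K, ((Function.Injective y ∧ a ∉ Set.range y) ∧ height y ≤ t ∧ (a : ℕ) < t)
        ↔ a ∈ (Finset.univ.filter fun a : Fin K => (a : ℕ) < t) \ Finset.univ.image y := by
      intro a
      simp only [h.1, h.2, true_and, Finset.mem_sdiff, Finset.mem_filter, Finset.mem_univ,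
        Finset.mem_image, Set.mem_range]
      tauto
    simp only [h1]
    rw [Finset.sum_ite_mem, Finset.univ_inter, Finset.sum_const, Finset.card_sdiff_of_subset,
      Finset.card_image_of_injective _ h.1, Finset.card_univ, Fintype.card_fin,
      Fin.card_filter_val_lt, min_eq_right htK, nsmul_eq_mul, descFactorial_cast_succ hmt.le,
      Nat.cast_sub hmt.le]
    · have : (0 : ℝ) < (t : ℝ) - m := by
        have : (m : ℝ) < t := by exact_mod_cast hmt
        linarith
      have := descFactorial_cast_pos hmt.le
      field_simp
    · intro a ha
      obtain ⟨j, -, rfl⟩ := Finset.mem_image.1 ha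
      simpa using (height_le_iff y t).1 h.2 j
  · rw [if_neg h]
    apply Finset.sum_eq_zero
    intro a _
    rw [if_neg]
    tauto

open Classical in
-- The record values are those from `height y` to `t - 1`. They are automatically unused, so they
-- are `t - height y` of the `t - m` equally likely continuations.
theorem sum_sampleProb_snoc_record {t m : ℕ} (hmt : m < t) (htK : t ≤ K) (y : Fin m → Fin K) :
    ∑ a : Fin K, (if height y ≤ a then sampleProb t (Fin.snoc y a : Fin (m + 1) → Fin K) else 0) =
      sampleProb t y * ((t - height y) / (t - m)) := by
  unfold sampleProb
  simp only [snoc_injective_iff, height_snoc_le_iff]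
  by_cases h : Function.Injective y ∧ height y ≤ t
  · rw [if_pos h]
    have h1 : ∀ a : Fin K, (if height y ≤ a then
        (if ((Function.Injective y ∧ a ∉ Set.range y) ∧ height y ≤ t ∧ (a : ℕ) < t) then
          1 / (t.descFactorial (m + 1) : ℝ) else 0) else 0)
        = if a ∈ (Finset.univ.filter fun a : Fin K => (a : ℕ) < t) \
          (Finset.univ.filter fun a : Fin K => (a : ℕ) < height y) then
          1 / (t.descFactorial (m + 1) : ℝ) else 0 := by
      intro a
      rw [← ite_and]
      congr 1
      simp only [h.1, h.2, true_and, Finset.mem_sdiff, Finset.mem_filter, Finset.mem_univ,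
        Set.mem_range, eq_iff_iff, not_lt]
      constructor
      · tauto
      · rintro ⟨ha, hb⟩
        refine ⟨hb, ?_, ha⟩
        rintro ⟨j, rfl⟩
        exact absurd ((height_le_iff y _).1 hb j) (lt_irrefl _)
    simp only [h1]
    rw [Finset.sum_ite_mem, Finset.univ_inter, Finset.sum_const, Finset.card_sdiff_of_subset,
      Fin.card_filter_val_lt, Fin.card_filter_val_lt, min_eq_right htK,
      min_eq_right (height_le y), nsmul_eq_mul, descFactorial_cast_succ hmt.le,
      Nat.cast_sub h.2]
    · have h2 : (0 : ℝ) < (t : ℝ) - m := by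
        have : (m : ℝ) < t := by exact_mod_cast hmt
        linarith
      have := descFactorial_cast_pos hmt.le
      field_simp
    · intro a ha
      simp only [Finset.mem_filter, Finset.mem_univ, true_and] at ha ⊢
      exact ha.trans_le h.2
  · rw [if_neg h, zero_mul]
    apply Finset.sum_eq_zero
    intro a _
    rw [if_neg (c := _ ∧ _), ite_self]
    tauto

/-- Sums over sequences of length `m + 1`, by the last term. -/
theorem sum_snoc {m : ℕ} {α : Type*} [Fintype α] (F : (Fin (m + 1) → α) → ℝ) :
    ∑ y, F y = ∑ z : Fin m → α, ∑ a : α, F (Fin.snoc z a) := by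
  rw [← (Fin.snocEquiv (fun _ => α)).sum_comp, Fintype.sum_prod_type, Finset.sum_comm]
  rfl

theorem sum_sampleProb_prefix {t i : ℕ} (htK : t ≤ K) (G : (Fin i → Fin K) → ℝ) {m : ℕ}
    (him : i ≤ m) (hmt : m ≤ t) :
    ∑ y : Fin m → Fin K, sampleProb t y * G (fun j => y (Fin.castLE him j)) =
      ∑ z, sampleProb t z * G z := by
  induction m, him using Nat.le_induction with
  | base => rfl
  | succ m hm ih =>
    rw [sum_snoc, ← ih (by omega)]
    refine Finset.sum_congr rfl fun z _ => ?_
    rw [← sum_sampleProb_snoc (by omega) htK z, Finset.sum_mul]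
    refine Finset.sum_congr rfl fun a _ => ?_
    congr 2
    funext j
    exact Fin.snoc_castSucc (α := fun _ => Fin K) a z (Fin.castLE hm j)

theorem sum_sampleProb {t m : ℕ} (htK : t ≤ K) (hmt : m ≤ t) :
    ∑ y : Fin m → Fin K, sampleProb t y = 1 := by
  have h := sum_sampleProb_prefix (K := K) (i := 0) htK (fun _ => 1) (Nat.zero_le m) hmt
  simp only [mul_one] at h
  rw [h, Fintype.sum_unique]
  simp [sampleProb, height, Function.injective_of_subsingleton]

end Weights

/-! ### The scale mixture and the near-independence of records -/

section Mixture

variable {K : ℕ}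

/-- The unnormalized mixture of the laws of sampling without replacement from `{0, …, t - 1}`,
`n ≤ t < K`, with the weights `1 / (t + 1)`. -/
noncomputable def seqWeight (n : ℕ) {m : ℕ} (y : Fin m → Fin K) : ℝ :=
  ∑ t ∈ Finset.Ico n K, 1 / ((t : ℝ) + 1) * sampleProb t y

/-- The total mass of the mixture. -/
noncomputable def totalWeight (n K : ℕ) : ℝ := ∑ t ∈ Finset.Ico n K, 1 / ((t : ℝ) + 1)

theorem seqWeight_nonneg (n : ℕ) {m : ℕ} (y : Fin m → Fin K) : 0 ≤ seqWeight n y :=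
  Finset.sum_nonneg fun t _ => mul_nonneg (by positivity) (sampleProb_nonneg t y)

theorem injective_of_seqWeight_ne_zero {n m : ℕ} {y : Fin m → Fin K} (h : seqWeight n y ≠ 0) :
    Function.Injective y := by
  by_contra hy
  exact h (Finset.sum_eq_zero fun t _ => by simp [sampleProb, hy])

theorem seqWeight_comp_perm (n : ℕ) {m : ℕ} (y : Fin m → Fin K) (σ : Equiv.Perm (Fin m)) :
    seqWeight n (y ∘ σ) = seqWeight n y := by
  have h : ∀ t, height (y ∘ σ) ≤ t ↔ height y ≤ t := by
    intro t
    simp only [height_le_iff, Function.comp]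
    exact ⟨fun h j => by simpa using h (σ.symm j), fun h j => h (σ j)⟩
  simp only [seqWeight, sampleProb, h, Equiv.injective_comp]

theorem sum_seqWeight_prefix {n i : ℕ} (G : (Fin i → Fin K) → ℝ) {m : ℕ}
    (him : i ≤ m) (hmn : m ≤ n) :
    ∑ y : Fin m → Fin K, seqWeight n y * G (fun j => y (Fin.castLE him j)) =
      ∑ z, seqWeight n z * G z := by
  simp only [seqWeight, Finset.sum_mul]
  rw [Finset.sum_comm, Finset.sum_comm (s := (Finset.univ : Finset (Fin i → Fin K)))]
  refine Finset.sum_congr rfl fun t ht => ?_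
  rw [Finset.mem_Ico] at ht
  simp only [mul_assoc, ← Finset.mul_sum]
  rw [sum_sampleProb_prefix ht.2.le G him (hmn.trans ht.1)]

theorem sum_seqWeight {n m : ℕ} (hmn : m ≤ n) :
    ∑ y : Fin m → Fin K, seqWeight n y = totalWeight n K := by
  simp only [seqWeight, totalWeight]
  rw [Finset.sum_comm]
  refine Finset.sum_congr rfl fun t ht => ?_
  rw [Finset.mem_Ico] at ht
  rw [← Finset.mul_sum, sum_sampleProb ht.2.le (hmn.trans ht.1), mul_one]

/-- Telescoping: `1/(t)_i - 1/(t+1)_i = i / ((t+1) (t)_i)`. The mixing weights `1/(t+1)` are chosen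
for this. -/
theorem mul_sum_one_div_descFactorial {i P K : ℕ} (hi : i ≤ P) (hPK : P ≤ K) :
    i * ∑ t ∈ Finset.Ico P K, 1 / ((t : ℝ) + 1) * (1 / (t.descFactorial i : ℝ)) =
      1 / (P.descFactorial i : ℝ) - 1 / (K.descFactorial i : ℝ) := by
  induction K, hPK using Nat.le_induction with
  | base => simp
  | succ t ht ih =>
    rw [Finset.sum_Ico_succ_top ht, mul_add, ih]
    have h1 := descFactorial_cast_pos (hi.trans ht)
    have h2 := descFactorial_cast_pos (hi.trans ht |>.trans (Nat.le_succ t))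
    have h3 : ((t : ℝ) + 1 - i) * ((t + 1).descFactorial i : ℝ)
        = (t + 1) * (t.descFactorial i : ℝ) := by
      have := Nat.succ_descFactorial t i
      have h4 : ((t + 1 - i : ℕ) : ℝ) = (t : ℝ) + 1 - i := by
        rw [Nat.cast_sub (by omega)]; push_cast; ring
      rw [← h4]
      exact_mod_cast this
    have h5 : (i : ℝ) * (1 / ((t : ℝ) + 1) * (1 / (t.descFactorial i : ℝ)))
        = 1 / (t.descFactorial i : ℝ) - 1 / ((t + 1).descFactorial i : ℝ) := by
      rw [Nat.succ_eq_add_one] at h2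
      field_simp
      linarith
    rw [h5]
    ring

/-- Since `(t-N)/(t-i) = 1 - (N-i)/(t-i)` with `N = height z`, the record mass splits into two sums
that both telescope. In the defect only boundary terms at the two ends of the range of `t` survive.
-/
theorem abs_record_defect_le {n i : ℕ} (hin : i < n) (hnK : n ≤ K) (z : Fin i → Fin K) :
    |∑ a : Fin K, (if height z ≤ a then seqWeight n (Fin.snoc z a : Fin (i + 1) → Fin K) else 0) -
      1 / (i + 1) * seqWeight n z| ≤ 1 / (i + 1) * (sampleProb K z + sampleProb n z) := by
  classical
  have h0 : ∑ a : Fin K, (if height z ≤ a then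
      seqWeight n (Fin.snoc z a : Fin (i + 1) → Fin K) else 0) =
      ∑ t ∈ Finset.Ico n K, 1 / ((t : ℝ) + 1) *
        (sampleProb t z * ((t - height z) / (t - i))) := by
    have : ∀ a : Fin K, (if height z ≤ a then
        seqWeight n (Fin.snoc z a : Fin (i + 1) → Fin K) else 0) =
        ∑ t ∈ Finset.Ico n K, 1 / ((t : ℝ) + 1) * (if height z ≤ a then
          sampleProb t (Fin.snoc z a : Fin (i + 1) → Fin K) else 0) := by
      intro a
      split_ifs <;> simp [seqWeight]
    simp only [this]
    rw [Finset.sum_comm]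
    refine Finset.sum_congr rfl fun t ht => ?_
    rw [Finset.mem_Ico] at ht
    rw [← Finset.mul_sum, sum_sampleProb_snoc_record (by omega) ht.2.le]
  rw [h0]
  by_cases hz : Function.Injective z
  swap
  · simp [seqWeight, sampleProb, hz]
  set N := height z with hN
  have hiN : i ≤ N := card_le_height hz
  have hNK : N ≤ K := height_le z
  -- Samples from fewer than `N` numbers cannot produce `z`, so the effective range of `t` starts at
  -- `max n N`.
  have hT : ∀ c : ℕ → ℝ, ∑ t ∈ Finset.Ico n K, 1 / ((t : ℝ) + 1) * (sampleProb t z * c t) =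
      ∑ t ∈ Finset.Ico (max n N) K, 1 / ((t : ℝ) + 1) * (1 / (t.descFactorial i : ℝ) * c t) := by
    intro c
    have : Finset.Ico (max n N) K = (Finset.Ico n K).filter (fun t => N ≤ t) := by
      ext t; simp only [Finset.mem_Ico, Finset.mem_filter]; omega
    rw [this, Finset.sum_filter]
    refine Finset.sum_congr rfl fun t _ => ?_
    simp only [sampleProb, hz, true_and, ← hN]
    split_ifs <;> simp
  set P := max n N with hP
  have hPn : n ≤ P := le_max_left _ _
  have hPK : P ≤ K := max_le hnK hNK
  have h1 : seqWeight n z = ∑ t ∈ Finset.Ico P K, 1 / ((t : ℝ) + 1) *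
      (1 / (t.descFactorial i : ℝ)) := by
    have := hT (fun _ => 1)
    simpa [seqWeight] using this
  have h2 : ∑ t ∈ Finset.Ico P K, 1 / ((t : ℝ) + 1) * (1 / (t.descFactorial i : ℝ) *
      (((t : ℝ) - N) / (t - i))) =
      ∑ t ∈ Finset.Ico P K, 1 / ((t : ℝ) + 1) * (1 / (t.descFactorial i : ℝ)) -
      (N - i) * ∑ t ∈ Finset.Ico P K, 1 / ((t : ℝ) + 1) *
        (1 / (t.descFactorial (i + 1) : ℝ)) := by
    rw [Finset.mul_sum, ← Finset.sum_sub_distrib]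
    refine Finset.sum_congr rfl fun t ht => ?_
    rw [Finset.mem_Ico] at ht
    have hit : i < t := by omega
    have hit' : (0 : ℝ) < (t : ℝ) - i := by
      have : (i : ℝ) < t := by exact_mod_cast hit
      linarith
    have := descFactorial_cast_pos hit.le
    rw [descFactorial_cast_succ hit.le]
    field_simp
    ring
  rw [hT (fun t => ((t : ℝ) - N) / (t - i)), h2, h1]
  have h3 := mul_sum_one_div_descFactorial (i := i) (by omega) hPK
  have h4 := mul_sum_one_div_descFactorial (i := i + 1) (by omega) hPK
  set T₀ := ∑ t ∈ Finset.Ico P K, 1 / ((t : ℝ) + 1) * (1 / (t.descFactorial i : ℝ))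
  set T₁ := ∑ t ∈ Finset.Ico P K, 1 / ((t : ℝ) + 1) * (1 / (t.descFactorial (i + 1) : ℝ))
  have hi0 : (0 : ℝ) < (i : ℝ) + 1 := by positivity
  have h5 : T₀ - (N - i) * T₁ - 1 / (i + 1) * T₀ =
      1 / (i + 1) * (i * T₀ - (N - i) * ((i + 1 : ℕ) * T₁)) := by
    push_cast; field_simp; ring
  rw [h5, abs_mul, abs_of_pos (by positivity : (0 : ℝ) < 1 / (i + 1))]
  apply mul_le_mul_of_nonneg_left _ (by positivity)
  rw [h3, h4, descFactorial_cast_succ (by omega : i ≤ P), descFactorial_cast_succ (by omega : i ≤ K)]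
  have hiN' : (i : ℝ) ≤ N := by exact_mod_cast hiN
  have hNP' : (N : ℝ) ≤ P := by exact_mod_cast (le_max_right n N)
  have hNK' : (N : ℝ) ≤ K := by exact_mod_cast hNK
  have hiP' : (i : ℝ) < P := by exact_mod_cast (by omega : i < P)
  have hiK' : (i : ℝ) < K := by exact_mod_cast (by omega : i < K)
  have hdP := descFactorial_cast_pos (by omega : i ≤ P)
  have hdK := descFactorial_cast_pos (by omega : i ≤ K)
  have hPi : (0 : ℝ) < (P : ℝ) - i := by linarith
  have hKi : (0 : ℝ) < (K : ℝ) - i := by linarith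
  have h6 : 1 / (P.descFactorial i : ℝ) - 1 / (K.descFactorial i : ℝ) -
      (N - i) * (1 / ((P - i) * (P.descFactorial i : ℝ)) - 1 / ((K - i) * (K.descFactorial i : ℝ)))
      = 1 / (P.descFactorial i : ℝ) * ((P - N) / (P - i)) -
        1 / (K.descFactorial i : ℝ) * ((K - N) / (K - i)) := by
    field_simp; ring
  rw [h6]
  have hK : 1 / (K.descFactorial i : ℝ) * ((K - N) / (K - i)) ≤ sampleProb K z := by
    have : sampleProb K z = 1 / (K.descFactorial i : ℝ) := if_pos ⟨hz, hNK⟩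
    rw [this]
    apply mul_le_of_le_one_right (by positivity)
    rw [div_le_one hKi]; linarith
  have hK0 : 0 ≤ 1 / (K.descFactorial i : ℝ) * ((K - N) / (K - i)) :=
    mul_nonneg (by positivity) (div_nonneg (by linarith) hKi.le)
  have hP0 : 0 ≤ 1 / (P.descFactorial i : ℝ) * ((P - N) / (P - i)) :=
    mul_nonneg (by positivity) (div_nonneg (by linarith) hPi.le)
  -- If the range starts at `N`, the factor `P - N` kills the lower boundary term; otherwise it
  -- starts at `n` and the term is at most `sampleProb n z`.
  have hPz : 1 / (P.descFactorial i : ℝ) * ((P - N) / (P - i)) ≤ sampleProb n z := by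
    rcases le_total N n with hNn | hNn
    · have hPe : P = n := max_eq_left hNn
      have : sampleProb n z = 1 / (P.descFactorial i : ℝ) := by
        rw [hPe]; exact if_pos ⟨hz, hNn⟩
      rw [this]
      apply mul_le_of_le_one_right (by positivity)
      rw [div_le_one hPi]; linarith
    · have hPe : P = N := max_eq_right hNn
      rw [hPe, sub_self, zero_div, mul_zero]
      exact sampleProb_nonneg n z
  have hs := sampleProb_nonneg K z
  have hs' := sampleProb_nonneg n z
  rw [abs_le]
  constructor <;> linarith

/-- The record at step `i` is nearly independent of the earlier values. -/
theorem abs_sum_record_sub_le {n : ℕ} (hnK : n ≤ K) (i : Fin n)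
    {F : (Fin n → Fin K) → ℝ} (hF : DependsOn F {j | j < i}) (hF0 : ∀ y, F y ∈ Set.Icc (0 : ℝ) 1) :
    |∑ y, seqWeight n y * (F y * if ∀ j < i, y j < y i then 1 else 0) -
      1 / ((i : ℕ) + 1) * ∑ y, seqWeight n y * F y| ≤ 2 := by
  classical
  have hin := i.2
  have hK : 0 < K := by omega
  have hle : (i : ℕ) ≤ n := hin.le
  -- Padding with 0 is harmless, as `F` does not look at the coordinates from `i` on.
  set G : (Fin i → Fin K) → ℝ := fun z =>
    F (fun j => if h : (j : ℕ) < i then z ⟨j, h⟩ else ⟨0, hK⟩) with hG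
  have hG0 : ∀ z, G z ∈ Set.Icc (0 : ℝ) 1 := fun z => hF0 _
  have hFG : ∀ y, F y = G (fun j => y (Fin.castLE hle j)) := by
    intro y
    apply hF
    intro j hj
    have hj' : (j : ℕ) < i := hj
    simp [hj', Fin.castLE]
  have h1 : ∑ y, seqWeight n y * F y = ∑ z, seqWeight n z * G z := by
    simp only [hFG]
    exact sum_seqWeight_prefix G hle le_rfl
  have hle' : (i : ℕ) + 1 ≤ n := hin
  have h2 : ∑ y, seqWeight n y * (F y * if ∀ j < i, y j < y i then 1 else 0) =
      ∑ z, G z * ∑ a : Fin K, (if height z ≤ a then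
        seqWeight n (Fin.snoc z a : Fin (i + 1) → Fin K) else 0) := by
    have hrec : ∀ y : Fin n → Fin K, (F y * if ∀ j < i, y j < y i then 1 else 0) =
        (fun z' : Fin (i + 1) → Fin K => G (Fin.init z') *
          if height (Fin.init z') ≤ z' (Fin.last _) then 1 else 0)
          (fun j => y (Fin.castLE hle' j)) := by
      intro y
      simp only
      rw [hFG y]
      congr 2
      rw [height_le_iff, eq_iff_iff]
      constructor
      · intro h j
        exact h _ (Fin.lt_def.2 j.2)
      · intro h j hj
        exact h ⟨j, hj⟩
    simp only [hrec]
    rw [sum_seqWeight_prefix (n := n) (fun z' : Fin (i + 1) → Fin K => G (Fin.init z') *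
          if height (Fin.init z') ≤ z' (Fin.last _) then 1 else 0) hle' le_rfl, sum_snoc]
    refine Finset.sum_congr rfl fun z _ => ?_
    rw [Finset.mul_sum]
    refine Finset.sum_congr rfl fun a _ => ?_
    simp only [Fin.init_snoc, Fin.snoc_last]
    split_ifs <;> ring
  rw [h1, h2, Finset.mul_sum, ← Finset.sum_sub_distrib]
  have hb : ∀ z : Fin i → Fin K, |G z * ∑ a : Fin K, (if height z ≤ a then
        seqWeight n (Fin.snoc z a : Fin (i + 1) → Fin K) else 0) -
        1 / ((i : ℕ) + 1) * (seqWeight n z * G z)| ≤ sampleProb K z + sampleProb n z := by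
    intro z
    have h := abs_record_defect_le hin hnK z
    have e : G z * ∑ a : Fin K, (if height z ≤ a then
        seqWeight n (Fin.snoc z a : Fin (i + 1) → Fin K) else 0) -
        1 / ((i : ℕ) + 1) * (seqWeight n z * G z) =
        G z * (∑ a : Fin K, (if height z ≤ a then
        seqWeight n (Fin.snoc z a : Fin (i + 1) → Fin K) else 0) -
        1 / ((i : ℕ) + 1) * seqWeight n z) := by ring
    rw [e, abs_mul, abs_of_nonneg (hG0 z).1]
    have hs : 0 ≤ sampleProb K z + sampleProb n z :=
      add_nonneg (sampleProb_nonneg K z) (sampleProb_nonneg n z)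
    refine (mul_le_of_le_one_left (abs_nonneg _) (hG0 z).2).trans (h.trans ?_)
    apply mul_le_of_le_one_left hs
    rw [div_le_one (by positivity)]
    have : (0 : ℝ) ≤ (i : ℕ) := by positivity
    linarith
  refine (Finset.abs_sum_le_sum_abs _ _).trans ((Finset.sum_le_sum fun z _ => hb z).trans ?_)
  rw [Finset.sum_add_distrib, sum_sampleProb le_rfl (by omega), sum_sampleProb hnK hle]
  norm_num

end Mixture

/-! ### The potential argument: no rule wins much more often than `1/e` -/

section Potential

variable {n : ℕ} {α : Type*}

/-- The probability of not stopping at the steps before `i`, if `q j y` is the conditional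
probability of stopping at step `j`. -/
def survival (q : Fin n → (Fin n → α) → ℝ) (i : ℕ) (y : Fin n → α) : ℝ :=
  ∏ j ∈ Finset.univ.filter (fun j : Fin n => (j : ℕ) < i), (1 - q j y)

theorem filter_lt_succ (i : Fin n) : Finset.univ.filter (fun j : Fin n => (j : ℕ) < (i : ℕ) + 1) =
    insert i (Finset.univ.filter (fun j : Fin n => (j : ℕ) < i)) := by
  ext j
  simp only [Finset.mem_filter, Finset.mem_univ, true_and, Finset.mem_insert, Fin.ext_iff]
  omega

theorem survival_succ (q : Fin n → (Fin n → α) → ℝ) (i : Fin n) (y : Fin n → α) :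
    survival q (i + 1) y = (1 - q i y) * survival q i y := by
  simp only [survival]
  rw [filter_lt_succ, Finset.prod_insert (by simp)]

theorem survival_mem {q : Fin n → (Fin n → α) → ℝ} (hq : ∀ i y, q i y ∈ Set.Icc (0 : ℝ) 1)
    (i : ℕ) (y : Fin n → α) : survival q i y ∈ Set.Icc (0 : ℝ) 1 :=
  ⟨Finset.prod_nonneg fun j _ => by linarith [(hq j y).2],
    Finset.prod_le_one (fun j _ => by linarith [(hq j y).2]) fun j _ => by linarith [(hq j y).1]⟩

theorem survival_dependsOn {q : Fin n → (Fin n → α) → ℝ}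
    (hd : ∀ i, DependsOn (q i) {j | j ≤ i}) (i : Fin n) :
    DependsOn (survival q i) {j | j < i} := by
  intro y y' h
  refine Finset.prod_congr rfl fun j hj => ?_
  have hji : j < i := (Finset.mem_filter.1 hj).2
  rw [hd j fun k hk => h k (lt_of_le_of_lt hk hji)]

/-- The probability to have stopped before step `i` at a strict maximum of the first `i` values. -/
noncomputable def lead [LT α] [DecidableLT α] (q : Fin n → (Fin n → α) → ℝ) (i : ℕ)
    (y : Fin n → α) : ℝ :=
  ∑ k ∈ Finset.univ.filter (fun k : Fin n => (k : ℕ) < i),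
    survival q k y * q k y * if ∀ j : Fin n, (j : ℕ) < i → j ≠ k → y j < y k then 1 else 0

theorem lead_nonneg [LT α] [DecidableLT α] {q : Fin n → (Fin n → α) → ℝ}
    (hq : ∀ i y, q i y ∈ Set.Icc (0 : ℝ) 1) (i : ℕ) (y : Fin n → α) : 0 ≤ lead q i y :=
  Finset.sum_nonneg fun k _ => mul_nonneg (mul_nonneg (survival_mem hq k y).1 (hq k y).1)
    (by split_ifs <;> norm_num)

theorem sum_stop_add_survival (q : Fin n → (Fin n → α) → ℝ) (i : ℕ) (hi : i ≤ n)
    (y : Fin n → α) :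
    ∑ k ∈ Finset.univ.filter (fun k : Fin n => (k : ℕ) < i), survival q k y * q k y +
      survival q i y = 1 := by
  induction i with
  | zero => simp [survival]
  | succ i ih =>
    have h := filter_lt_succ (⟨i, hi⟩ : Fin n)
    have h2 := survival_succ q ⟨i, hi⟩ y
    simp only at h h2
    rw [h, h2, Finset.sum_insert (by simp)]
    have := ih (by omega)
    simp only
    linarith

theorem lead_le_one [LT α] [DecidableLT α] {q : Fin n → (Fin n → α) → ℝ}
    (hq : ∀ i y, q i y ∈ Set.Icc (0 : ℝ) 1) (i : ℕ) (hi : i ≤ n) (y : Fin n → α) :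
    lead q i y ≤ 1 := by
  have h1 := sum_stop_add_survival q i hi y
  have h2 := (survival_mem hq i y).1
  refine le_trans (Finset.sum_le_sum fun k _ => ?_) (by linarith :
    ∑ k ∈ Finset.univ.filter (fun k : Fin n => (k : ℕ) < i), survival q k y * q k y ≤ 1)
  apply mul_le_of_le_one_right (mul_nonneg (survival_mem hq k y).1 (hq k y).1)
  split_ifs <;> norm_num

theorem lead_dependsOn [LT α] [DecidableLT α] {q : Fin n → (Fin n → α) → ℝ}
    (hd : ∀ i, DependsOn (q i) {j | j ≤ i}) (i : Fin n) :
    DependsOn (lead q i) {j | j < i} := by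
  intro y y' h
  refine Finset.sum_congr rfl fun k hk => ?_
  have hki : k < i := (Finset.mem_filter.1 hk).2
  rw [hd k fun j hj => h j (lt_of_le_of_lt hj hki),
    survival_dependsOn hd k fun j hj => h j (lt_trans hj hki)]
  congr 2
  rw [eq_iff_iff]
  refine forall_congr' fun j => ?_
  constructor
  · intro H hj hjk; rw [← h j hj, ← h k hki]; exact H hj hjk
  · intro H hj hjk; rw [h j hj, h k hki]; exact H hj hjk

/-- A record at step `i` dethrones every earlier leader, and a new leader arises only by stopping at
a record. -/
theorem lead_succ_le [Preorder α] [DecidableLT α] {q : Fin n → (Fin n → α) → ℝ}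
    (hq : ∀ i y, q i y ∈ Set.Icc (0 : ℝ) 1) (i : Fin n) (y : Fin n → α) :
    lead q (i + 1) y ≤ lead q i y - lead q i y * (if ∀ j < i, y j < y i then 1 else 0) +
      survival q i y * q i y * (if ∀ j < i, y j < y i then 1 else 0) := by
  rw [lead, filter_lt_succ, Finset.sum_insert (by simp)]
  have h1 : (if ∀ j : Fin n, (j : ℕ) < (i : ℕ) + 1 → j ≠ i → y j < y i then (1 : ℝ) else 0) =
      if ∀ j < i, y j < y i then 1 else 0 := by
    congr 1
    rw [eq_iff_iff]
    refine forall_congr' fun j => ⟨fun H hj => H (by have : (j : ℕ) < i := hj; omega) hj.ne,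
      fun H hj hji => H ?_⟩
    rw [Fin.lt_def]
    have : (j : ℕ) ≠ i := fun h => hji (Fin.ext h)
    omega
  have h2 : ∀ k ∈ Finset.univ.filter (fun k : Fin n => (k : ℕ) < i),
      survival q k y * q k y *
        (if ∀ j : Fin n, (j : ℕ) < (i : ℕ) + 1 → j ≠ k → y j < y k then (1 : ℝ) else 0) ≤
      survival q k y * q k y *
        (if ∀ j : Fin n, (j : ℕ) < i → j ≠ k → y j < y k then 1 else 0) *
        (1 - if ∀ j < i, y j < y i then 1 else 0) := by
    intro k hk
    have hki : k < i := (Finset.mem_filter.1 hk).2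
    rw [mul_assoc (survival q k y * q k y)]
    apply mul_le_mul_of_nonneg_left _ (mul_nonneg (survival_mem hq k y).1 (hq k y).1)
    by_cases H : ∀ j : Fin n, (j : ℕ) < (i : ℕ) + 1 → j ≠ k → y j < y k
    · have H1 : ∀ j : Fin n, (j : ℕ) < i → j ≠ k → y j < y k := fun j hj => H j (by omega)
      have H2 : ¬ ∀ j < i, y j < y i := fun h => lt_asymm (h k hki) (H i (by omega) hki.ne')
      rw [if_pos H, if_pos H1, if_neg H2]
      norm_num
    · rw [if_neg H]
      apply mul_nonneg <;> split_ifs <;> norm_num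
  rw [h1, add_comm]
  refine add_le_add ((Finset.sum_le_sum h2).trans (le_of_eq ?_)) le_rfl
  rw [← Finset.sum_mul, lead]
  ring

/-- No rule picks the maximum of the mixture with probability much larger than `1 / e`. -/
theorem sum_seqWeight_lead_le {K : ℕ} (hn : 3 ≤ n) (hnK : n ≤ K)
    {q : Fin n → (Fin n → Fin K) → ℝ} (hq : ∀ i y, q i y ∈ Set.Icc (0 : ℝ) 1)
    (hd : ∀ i, DependsOn (q i) {j | j ≤ i}) :
    ∑ y, seqWeight n y * lead q n y ≤ (1 / Real.exp 1 + 1 / n) * totalWeight n K + 4 * n := by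
  have hn0 : (0 : ℝ) < n := by exact_mod_cast (by omega : 0 < n)
  -- The factor `i/n` is the chance that the leader of the first `i` values is the overall maximum.
  -- At `i = n` the potential is the winning mass, at `i = 0` it is `dualValue n 0` times the total
  -- mass.
  have key : ∀ i, i ≤ n → (i / n : ℝ) * ∑ y, seqWeight n y * lead q i y +
      dualValue n i * ∑ y, seqWeight n y * survival q i y ≤
      dualValue n 0 * totalWeight n K + 4 * i := by
    intro i hi
    induction i with
    | zero => simp [survival, sum_seqWeight le_rfl]
    | succ i ih =>
      have ih := ih (by omega)
      set I : Fin n := ⟨i, hi⟩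
      have hA := abs_sum_record_sub_le hnK I (F := lead q i) (lead_dependsOn hd I)
        (fun y => ⟨lead_nonneg hq _ y, lead_le_one hq _ (by omega) y⟩)
      have hB := abs_sum_record_sub_le hnK I (F := survival q i) (survival_dependsOn hd I)
        (fun y => survival_mem hq _ y)
      have hIi : ((I : ℕ) : ℝ) = i := rfl
      rw [hIi] at hA hB
      set R : (Fin n → Fin K) → ℝ := fun y => if ∀ j < I, y j < y I then 1 else 0 with hR
      have hR0 : ∀ y, 0 ≤ R y ∧ R y ≤ 1 := by
        intro y; simp only [hR]; split_ifs <;> norm_num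
      set ρ := ∑ y, seqWeight n y * (survival q i y * q I y * R y) with hρ
      set A := ∑ y, seqWeight n y * lead q i y
      set B := ∑ y, seqWeight n y * survival q i y
      have hw := fun y : Fin n → Fin K => seqWeight_nonneg n y
      have hρ0 : 0 ≤ ρ := Finset.sum_nonneg fun y _ => mul_nonneg (hw y)
        (mul_nonneg (mul_nonneg (survival_mem hq _ y).1 (hq I y).1) (hR0 y).1)
      have hρB : ρ ≤ 1 / (i + 1) * B + 2 := by
        have : ρ ≤ ∑ y, seqWeight n y * (survival q i y * R y) := by
          refine Finset.sum_le_sum fun y _ => mul_le_mul_of_nonneg_left ?_ (hw y)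
          exact mul_le_mul_of_nonneg_right
            (mul_le_of_le_one_right (survival_mem hq _ y).1 (hq I y).2) (hR0 y).1
        linarith [(abs_le.1 hB).2]
      have hA' : ∑ y, seqWeight n y * lead q (i + 1) y ≤ A - 1 / (i + 1) * A + 2 + ρ := by
        have : ∑ y, seqWeight n y * lead q (i + 1) y ≤
            A - ∑ y, seqWeight n y * (lead q i y * R y) + ρ := by
          rw [hρ, ← Finset.sum_sub_distrib, ← Finset.sum_add_distrib]
          refine Finset.sum_le_sum fun y _ => ?_
          rw [← mul_sub, ← mul_add]
          exact mul_le_mul_of_nonneg_left (lead_succ_le hq I y) (hw y)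
        linarith [(abs_le.1 hA).1]
      have hB' : ∑ y, seqWeight n y * survival q (i + 1) y ≤ B - ρ := by
        rw [hρ, ← Finset.sum_sub_distrib]
        refine Finset.sum_le_sum fun y _ => ?_
        rw [← mul_sub]
        refine mul_le_mul_of_nonneg_left ?_ (hw y)
        have h1 := survival_succ q I y
        have h2 : survival q i y * q I y * R y ≤ survival q i y * q I y :=
          mul_le_of_le_one_right (mul_nonneg (survival_mem hq _ y).1 (hq I y).1) (hR0 y).2
        calc survival q (i + 1) y = (1 - q I y) * survival q i y := h1
          _ ≤ _ := by linarith
      have hB0 : 0 ≤ B := Finset.sum_nonneg fun y _ => mul_nonneg (hw y) (survival_mem hq _ y).1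
      have hv0 := dualValue_nonneg n (i + 1)
      have hv1 := dualValue_succ_le (n := n) (i := i) hi
      have hv2 := mul_dualValue_add_le (n := n) (i := i) hi
      have hin : ((i : ℝ) + 1) / n ≤ 1 := by
        rw [div_le_one hn0]; exact_mod_cast hi
      set v := dualValue n (i + 1)
      set A' := ∑ y, seqWeight n y * lead q (i + 1) y
      set B' := ∑ y, seqWeight n y * survival q (i + 1) y
      push_cast
      have hi0 : (0 : ℝ) < (i : ℝ) + 1 := by positivity
      have e1 : ((i : ℝ) + 1) / n * A' ≤ ((i : ℝ) + 1) / n * (A - 1 / (i + 1) * A + 2 + ρ) := by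
        gcongr
      have e2 : v * B' ≤ v * (B - ρ) := by gcongr
      have e3 : ((i : ℝ) + 1) / n * (A - 1 / (i + 1) * A + 2 + ρ) =
          i / n * A + 2 * (((i : ℝ) + 1) / n) + ((i : ℝ) + 1) / n * ρ := by field_simp; ring
      -- The left side is linear in the mass `ρ` stopped at a record, which lies between 0 and
      -- `B/(i+1) + 2`. The two cases correspond to the two ends of this interval, and to the two
      -- dual constraints.
      have e4 : v * B + (((i : ℝ) + 1) / n - v) * ρ ≤ dualValue n i * B + 2 := by
        rcases le_total v (((i : ℝ) + 1) / n) with hc | hc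
        · calc v * B + (((i : ℝ) + 1) / n - v) * ρ
              ≤ v * B + (((i : ℝ) + 1) / n - v) * (1 / (i + 1) * B + 2) := by
                gcongr
            _ = (i / (i + 1) * v + 1 / n) * B + 2 * (((i : ℝ) + 1) / n - v) := by
                field_simp; ring
            _ ≤ _ := by
                have := mul_le_mul_of_nonneg_right hv2 hB0
                linarith
        · have h1 : (((i : ℝ) + 1) / n - v) * ρ ≤ 0 :=
            mul_nonpos_of_nonpos_of_nonneg (by linarith) hρ0
          have := mul_le_mul_of_nonneg_right hv1 hB0
          linarith
      linarith
  have h := key n le_rfl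
  rw [dualValue_self, zero_mul, add_zero, div_self hn0.ne', one_mul] at h
  refine h.trans ?_
  have hH : 0 ≤ totalWeight n K := Finset.sum_nonneg fun _ _ => by positivity
  have := mul_le_mul_of_nonneg_right (dualValue_zero_le hn) hH
  linarith

end Potential

/-! ### The expected reward of a stopping rule -/

theorem StoppingRule.measurable_stopProb {n : ℕ} (r : StoppingRule n) (i : Fin n) :
    Measurable (r.stopProb i) := by
  have h : ∀ j : Fin n, Measurable fun x : Fin n → ℝ => r.prob j (fun k => x k) := fun j =>
    (r.measurable_prob j).comp (by fun_prop)
  exact (Finset.measurable_prod _ fun j _ => measurable_const.sub (h j)).mul (h i)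

theorem StoppingRule.stopProb_mem {n : ℕ} (r : StoppingRule n) (i : Fin n) (x : Fin n → ℝ) :
    r.stopProb i x ∈ Set.Icc (0 : ℝ) 1 := by
  have h0 : 0 ≤ ∏ j ∈ Finset.Iio i, (1 - r.prob j (fun k => x k)) :=
    Finset.prod_nonneg fun j _ => by linarith [(r.prob_mem j (fun k => x k)).2]
  have h1 : ∏ j ∈ Finset.Iio i, (1 - r.prob j (fun k => x k)) ≤ 1 :=
    Finset.prod_le_one (fun j _ => by linarith [(r.prob_mem j (fun k => x k)).2])
      fun j _ => by linarith [(r.prob_mem j (fun k => x k)).1]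
  exact ⟨mul_nonneg h0 (r.prob_mem i _).1,
    mul_le_one₀ h1 (r.prob_mem i _).1 (r.prob_mem i _).2⟩

theorem stopped_of_eq_coe {n : ℕ} {Ω : Type u} (X : Fin n → Ω → ℝ) {τ : Ω → WithTop (Fin n)}
    {ω : Ω} {i : Fin n} (h : τ ω = i) : stopped X τ ω = X i ω := by
  unfold stopped
  rw [h]
  rfl

theorem stopped_of_eq_top {n : ℕ} {Ω : Type u} (X : Fin n → Ω → ℝ) {τ : Ω → WithTop (Fin n)}
    {ω : Ω} (h : τ ω = ⊤) : stopped X τ ω = 0 := by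
  unfold stopped
  rw [h]
  rfl

theorem stopped_eq_sum {n : ℕ} {Ω : Type u} (X : Fin n → Ω → ℝ) (τ : Ω → WithTop (Fin n))
    (ω : Ω) : stopped X τ ω =
      ∑ i : Fin n, ({ω | τ ω = (i : WithTop (Fin n))}.indicator (X i)) ω := by
  rcases eq_or_ne (τ ω) ⊤ with h | h
  · simp [stopped_of_eq_top X h, h]
  · obtain ⟨i, hi⟩ := WithTop.ne_top_iff_exists.1 h
    simp [stopped_of_eq_coe X hi.symm, Set.indicator_apply, ← hi]

theorem integral_indicator_eq_integral_mul {Ω : Type*} {m mΩ : MeasurableSpace Ω} (hm : m ≤ mΩ)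
    {P : Measure Ω} [IsProbabilityMeasure P] {f p : Ω → ℝ} (hf : StronglyMeasurable[m] f)
    (hint : Integrable f P) {S : Set Ω} (hS : MeasurableSet S) (hp : P⟦S | m⟧ =ᵐ[P] p) :
    ∫ ω, S.indicator f ω ∂P = ∫ ω, p ω * f ω ∂P := by
  have h1 : S.indicator f = f * S.indicator (fun _ => (1 : ℝ)) := by
    ext ω; by_cases h : ω ∈ S <;> simp [h]
  have h2 : P[f * S.indicator (fun _ => (1 : ℝ)) | m] =ᵐ[P]
      f * P[S.indicator (fun _ => (1 : ℝ)) | m] :=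
    condExp_mul_of_stronglyMeasurable_left hf (h1 ▸ hint.indicator hS)
      ((integrable_const 1).indicator hS)
  rw [h1, ← integral_condExp hm]
  apply integral_congr_ae
  filter_upwards [h2, hp] with ω h3 h4
  rw [h3, Pi.mul_apply, mul_comm, h4]

theorem integrable_stopProb_mul {n : ℕ} {Ω : Type*} [MeasurableSpace Ω] {P : Measure Ω}
    {X : Fin n → Ω → ℝ} (hX : ∀ i, Measurable (X i)) (hint : ∀ i, Integrable (X i) P)
    (r : StoppingRule n) (i : Fin n) :
    Integrable (fun ω => r.stopProb i (fun j => X j ω) * X i ω) P := by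
  refine (hint i).bdd_mul (c := 1) ((r.measurable_stopProb i).comp
    (measurable_pi_lambda _ hX)).aestronglyMeasurable (Filter.Eventually.of_forall ?_)
  intro ω
  have := r.stopProb_mem i (fun j => X j ω)
  exact (Real.norm_of_nonneg this.1).trans_le this.2

/-- The expected reward is determined by the rule and the law of the sequence. -/
theorem integral_stopped {n : ℕ} {Ω : Type u} [MeasurableSpace Ω] {P : Measure Ω}
    [IsProbabilityMeasure P] {X : Fin n → Ω → ℝ} (hX : ∀ i, Measurable (X i))
    (hint : ∀ i, Integrable (X i) P) {r : StoppingRule n} {τ : Ω → WithTop (Fin n)}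
    (hτ : IsStoppingTimeOf r X τ P) :
    ∫ ω, stopped X τ ω ∂P = ∫ ω, ∑ i, r.stopProb i (fun j => X j ω) * X i ω ∂P := by
  have hXm : Measurable fun ω (j : Fin n) => X j ω := measurable_pi_lambda _ hX
  simp only [stopped_eq_sum]
  rw [integral_finsetSum _ fun i _ => (hint i).indicator (hτ i).1,
    integral_finsetSum _ fun i _ => integrable_stopProb_mul hX hint r i]
  refine Finset.sum_congr rfl fun i _ => ?_
  refine integral_indicator_eq_integral_mul hXm.comap_le (Measurable.stronglyMeasurable ?_)
    (hint i) (hτ i).1 (hτ i).2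
  exact (measurable_pi_apply i).comp (comap_measurable fun ω (j : Fin n) => X j ω)

/-! ### Finitely supported laws -/

/-- The law that gives mass `p y` to the point `x y`. -/
noncomputable def finiteLaw {ι E : Type*} [Fintype ι] [MeasurableSpace E] (p : ι → ℝ) (x : ι → E) :
    Measure E :=
  ∑ y, ENNReal.ofReal (p y) • Measure.dirac (x y)

theorem isProbabilityMeasure_finiteLaw {ι E : Type*} [Fintype ι] [MeasurableSpace E] {p : ι → ℝ}
    (hp : ∀ y, 0 ≤ p y) (h1 : ∑ y, p y = 1) (x : ι → E) :
    IsProbabilityMeasure (finiteLaw p x) := by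
  constructor
  simp [finiteLaw, ← ENNReal.ofReal_sum_of_nonneg (fun y _ => hp y), h1]

theorem integral_finiteLaw {ι E : Type*} [Fintype ι] [MeasurableSpace E]
    [MeasurableSingletonClass E] {p : ι → ℝ} (hp : ∀ y, 0 ≤ p y) (x : ι → E) (F : E → ℝ) :
    ∫ e, F e ∂(finiteLaw p x) = ∑ y, p y * F (x y) := by
  unfold finiteLaw
  rw [integral_finsetSum_measure]
  · refine Finset.sum_congr rfl fun y _ => ?_
    rw [integral_smul_measure, integral_dirac, ENNReal.toReal_ofReal (hp y), smul_eq_mul]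
  · intro y _
    exact (integrable_dirac (by simp)).smul_measure ENNReal.ofReal_ne_top

theorem ae_finiteLaw {ι E : Type*} [Fintype ι] [MeasurableSpace E]
    [MeasurableSingletonClass E] (p : ι → ℝ) (x : ι → E) {Q : E → Prop}
    (hQ : ∀ y, Q (x y)) : ∀ᵐ e ∂(finiteLaw p x), Q e := by
  have : ∀ᵐ e ∂(finiteLaw p x), e ∈ Set.range x := by
    rw [ae_iff]
    simp only [finiteLaw, Measure.coe_finsetSum, Finset.sum_apply, Measure.smul_apply]
    refine Finset.sum_eq_zero fun y _ => ?_
    have : Measure.dirac (x y) (Set.range x)ᶜ = 0 := by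
      rw [Measure.dirac_apply' _ (Set.finite_range x).measurableSet.compl]
      simp
    exact (congrArg _ this).trans (smul_zero _)
  filter_upwards [this] with e he
  obtain ⟨y, rfl⟩ := he
  exact hQ y

theorem map_finiteLaw {ι E E' : Type*} [Fintype ι] [MeasurableSpace E] [MeasurableSpace E']
    (p : ι → ℝ) (x : ι → E) {f : E → E'} (hf : Measurable f) :
    (finiteLaw p x).map f = finiteLaw p (fun y => f (x y)) := by
  unfold finiteLaw
  rw [Measure.map_finset_sum hf.aemeasurable]
  refine Finset.sum_congr rfl fun y _ => ?_
  rw [Measure.map_smul, Measure.map_dirac' hf]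

theorem finiteLaw_comp_equiv {ι E : Type*} [Fintype ι] [MeasurableSpace E] (p : ι → ℝ) (x : ι → E)
    (e : ι ≃ ι) : finiteLaw (fun y => p (e y)) (fun y => x (e y)) = finiteLaw p x :=
  e.sum_comp fun y => ENNReal.ofReal (p y) • Measure.dirac (x y)

theorem exists_totalWeight_ge (n : ℕ) (C : ℝ) : ∃ K, n ≤ K ∧ C ≤ totalWeight n K := by
  have h := Real.tendsto_sum_range_one_div_nat_succ_atTop
  obtain ⟨K, hK, h⟩ := ((h.eventually_ge_atTop (C + ∑ i ∈ Finset.range n, 1 / ((i : ℝ) + 1))).and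
    (Filter.eventually_ge_atTop n)).exists
  refine ⟨K, h, ?_⟩
  rw [totalWeight, Finset.sum_Ico_eq_sub _ h]
  linarith

/-! ### The hard exchangeable law -/

section HardLaw

variable {n K : ℕ}

/-- Geometrically growing values `ε ^ (K - a)`, for `a < K`. -/
def geomValue (ε : ℝ) (a : Fin K) : ℝ := ε ^ (K - (a : ℕ))

theorem geomValue_pos {ε : ℝ} (hε : 0 < ε) (a : Fin K) : 0 < geomValue ε a := pow_pos hε _

theorem geomValue_le_one {ε : ℝ} (hε : 0 < ε) (hε1 : ε ≤ 1) (a : Fin K) : geomValue ε a ≤ 1 :=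
  pow_le_one₀ hε.le hε1

theorem geomValue_le_mul {ε : ℝ} (hε : 0 < ε) (hε1 : ε ≤ 1) {a b : Fin K} (h : a < b) :
    geomValue ε a ≤ ε * geomValue ε b := by
  have h1 := Fin.lt_def.1 h
  have h2 := b.2
  rw [geomValue, geomValue, ← pow_succ']
  exact pow_le_pow_of_le_one hε.le hε1 (by omega)

theorem le_iSup_fin (x : Fin n → ℝ) (i : Fin n) : x i ≤ ⨆ j, x j :=
  le_ciSup (Set.finite_range x).bddAbove i

/-- Stopping at the maximum earns `M`; stopping anywhere else earns at most `ε M`, by geometric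
growth and injectivity. -/
theorem sum_stop_mul_geomValue_le {ε : ℝ} (hε : 0 < ε) (hε1 : ε ≤ 1)
    {q : Fin n → (Fin n → Fin K) → ℝ} (hq : ∀ i y, q i y ∈ Set.Icc (0 : ℝ) 1)
    {y : Fin n → Fin K} (hy : Function.Injective y) :
    ∑ i : Fin n, survival q i y * q i y * geomValue ε (y i) ≤
      (⨆ i, geomValue ε (y i)) * (lead q n y + ε) := by
  set M := ⨆ i, geomValue ε (y i) with hM
  have hMi : ∀ i, geomValue ε (y i) ≤ M := fun i => le_iSup_fin (fun i => geomValue ε (y i)) i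
  have hM0 : 0 ≤ M := Real.iSup_nonneg fun i => (geomValue_pos hε _).le
  have hs0 : ∀ i : Fin n, 0 ≤ survival q i y * q i y := fun i =>
    mul_nonneg (survival_mem hq i y).1 (hq i y).1
  have hsum : ∑ i : Fin n, survival q i y * q i y ≤ 1 := by
    have h1 := sum_stop_add_survival q n le_rfl y
    have h2 := (survival_mem hq n y).1
    simp only [Fin.is_lt, Finset.filter_true] at h1
    linarith
  have h : ∀ i : Fin n, survival q i y * q i y * geomValue ε (y i) ≤
      M * (survival q i y * q i y * (if ∀ j : Fin n, (j : ℕ) < n → j ≠ i → y j < y i then 1 else 0))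
        + M * ε * (survival q i y * q i y) := by
    intro i
    split_ifs with hi
    · have h1 := mul_le_mul_of_nonneg_left (hMi i) (hs0 i)
      have h2 : 0 ≤ M * ε * (survival q i y * q i y) :=
        mul_nonneg (mul_nonneg hM0 hε.le) (hs0 i)
      linarith
    · push Not at hi
      obtain ⟨j, -, hji, hj⟩ := hi
      have hlt : y i < y j := lt_of_le_of_ne hj fun h => hji (hy h).symm
      have h1 : geomValue ε (y i) ≤ M * ε := by
        refine (geomValue_le_mul hε hε1 hlt).trans ?_
        rw [mul_comm]
        exact mul_le_mul_of_nonneg_right (hMi j) hε.le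
      have h2 := mul_le_mul_of_nonneg_left h1 (hs0 i)
      linarith
  refine (Finset.sum_le_sum fun i _ => h i).trans ?_
  rw [Finset.sum_add_distrib, ← Finset.mul_sum, ← Finset.mul_sum, mul_add]
  have hl : lead q n y = ∑ i : Fin n, (survival q i y * q i y *
      (if ∀ j : Fin n, (j : ℕ) < n → j ≠ i → y j < y i then 1 else 0)) := by
    rw [lead]
    simp only [Fin.is_lt, Finset.filter_true]
  rw [← hl]
  have := mul_le_mul_of_nonneg_left hsum (mul_nonneg hM0 hε.le)
  linarith

/-- The unnormalized mass of `y` in the hard law: the mixture, reweighted by the maximum. -/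
noncomputable def hardMass (ε : ℝ) (y : Fin n → Fin K) : ℝ :=
  seqWeight n y / ⨆ i, geomValue ε (y i)

/-- An exchangeable law on which no stopping rule is much better than `1 / e`. -/
noncomputable def hardLaw (n K : ℕ) (ε : ℝ) : Measure (Fin n → ℝ) :=
  finiteLaw (fun y : Fin n → Fin K => hardMass ε y / ∑ z : Fin n → Fin K, hardMass ε z)
    fun y i => geomValue ε (y i)

theorem hardMass_comp_perm (ε : ℝ) (y : Fin n → Fin K) (σ : Equiv.Perm (Fin n)) :
    hardMass ε (y ∘ σ) = hardMass ε y := by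
  rw [hardMass, hardMass, seqWeight_comp_perm]
  congr 1
  exact σ.iSup_comp (g := fun i => geomValue ε (y i))

theorem exchangeable_hardLaw (n K : ℕ) (ε : ℝ) :
    Exchangeable (fun (i : Fin n) (x : Fin n → ℝ) => x i) (hardLaw n K ε) := by
  intro σ
  rw [hardLaw, map_finiteLaw _ _ (by fun_prop), map_finiteLaw _ _ (by fun_prop)]
  set p := fun y : Fin n → Fin K => hardMass ε y / ∑ z : Fin n → Fin K, hardMass ε z with hp
  have h1 := finiteLaw_comp_equiv p (fun (y : Fin n → Fin K) i => geomValue ε (y i))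
    (Equiv.arrowCongr σ.symm (Equiv.refl (Fin K)))
  have h2 : ∀ y : Fin n → Fin K, Equiv.arrowCongr σ.symm (Equiv.refl (Fin K)) y = y ∘ σ :=
    fun y => rfl
  simp only [h2] at h1
  have h3 : (fun y => p (y ∘ σ)) = p := by
    funext y
    simp only [hp, hardMass_comp_perm]
  rw [h3] at h1
  exact h1

theorem hardMass_nonneg {ε : ℝ} (hε : 0 < ε) (y : Fin n → Fin K) : 0 ≤ hardMass ε y :=
  div_nonneg (seqWeight_nonneg n y) (Real.iSup_nonneg fun _ => (geomValue_pos hε _).le)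

theorem iSup_geomValue_pos (hn : 0 < n) {ε : ℝ} (hε : 0 < ε) (y : Fin n → Fin K) :
    0 < ⨆ i, geomValue ε (y i) :=
  (geomValue_pos hε _).trans_le (le_iSup_fin (fun i => geomValue ε (y i)) ⟨0, hn⟩)

theorem sum_hardMass_pos (hn : 0 < n) {ε : ℝ} (hε : 0 < ε) (hH : 0 < totalWeight n K) :
    0 < ∑ z : Fin n → Fin K, hardMass ε z := by
  rw [← sum_seqWeight (K := K) le_rfl] at hH
  obtain ⟨y, -, hy⟩ := Finset.exists_ne_zero_of_sum_ne_zero hH.ne'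
  refine Finset.sum_pos' (fun z _ => hardMass_nonneg hε z) ⟨y, Finset.mem_univ _, ?_⟩
  exact div_pos ((seqWeight_nonneg n y).lt_of_ne' hy) (iSup_geomValue_pos hn hε y)

theorem exists_hard_law {δ : ℝ} (hδ : 0 < δ) : ∃ n₀ : ℕ, ∀ n : ℕ, n₀ ≤ n →
      ∃ ν : Measure (Fin n → ℝ), IsProbabilityMeasure ν ∧
        Exchangeable (fun (i : Fin n) (x : Fin n → ℝ) => x i) ν ∧
        (∀ᵐ x ∂ν, ∀ i, x i ∈ Set.Icc (0 : ℝ) 1) ∧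
        0 < ∫ x, (⨆ i, x i) ∂ν ∧
        ∀ (Ω : Type u) [MeasurableSpace Ω] (P : Measure Ω) [IsProbabilityMeasure P]
          (X : Fin n → Ω → ℝ), (∀ i, Measurable (X i)) →
          P.map (fun ω (i : Fin n) => X i ω) = ν →
          ∀ (r : StoppingRule n) (τ : Ω → WithTop (Fin n)),
            IsStoppingTimeOf r X τ P →
            ∫ ω, stopped X τ ω ∂P
              ≤ (1 / Real.exp 1 + δ) * ∫ ω, (⨆ i, X i ω) ∂P := by
  -- The excess `δ` is split into three thirds: for `1/n`, for the accumulated error `4n` relative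
  -- to `totalWeight n K`, and for `ε`.
  obtain ⟨N, hN⟩ := exists_nat_gt (3 / δ)
  refine ⟨max 3 N, fun n hn => ?_⟩
  have hn3 : 3 ≤ n := (le_max_left _ _).trans hn
  have hn0 : 0 < n := by omega
  have hn0' : (0 : ℝ) < n := by exact_mod_cast hn0
  have hNn : (N : ℝ) ≤ n := by exact_mod_cast (le_max_right _ _).trans hn
  have hδn : 1 / (n : ℝ) ≤ δ / 3 := by
    rw [div_le_div_iff₀ hn0' (by norm_num)]
    have := (div_lt_iff₀ hδ).1 (hN.trans_le hNn)
    linarith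
  obtain ⟨K, hnK, hK⟩ := exists_totalWeight_ge n (12 * n / δ)
  have hH0 : 0 < totalWeight n K := lt_of_lt_of_le (by positivity) hK
  have hK' : 4 * (n : ℝ) ≤ δ / 3 * totalWeight n K := by
    rw [div_le_iff₀ hδ] at hK; linarith
  set ε := min 1 (δ / 3) with hεdef
  have hε : 0 < ε := lt_min one_pos (by positivity)
  have hε1 : ε ≤ 1 := min_le_left _ _
  have hεδ : ε ≤ δ / 3 := min_le_right _ _
  set Z := ∑ z : Fin n → Fin K, hardMass ε z with hZ
  have hZ0 : 0 < Z := sum_hardMass_pos hn0 hε hH0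
  have hp : ∀ y : Fin n → Fin K, 0 ≤ hardMass ε y / Z := fun y =>
    div_nonneg (hardMass_nonneg hε y) hZ0.le
  have hp1 : ∑ y : Fin n → Fin K, hardMass ε y / Z = 1 := by
    rw [← Finset.sum_div, ← hZ, div_self hZ0.ne']
  -- The reweighting cancels the maximum, so that expectations of the form maximum times ratio
  -- become mixture averages of the ratio.
  have hMy : ∀ y : Fin n → Fin K, hardMass ε y / Z * (⨆ i, geomValue ε (y i)) =
      seqWeight n y / Z := by
    intro y
    have := (iSup_geomValue_pos hn0 hε y).ne'
    rw [hardMass]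
    field_simp
  have hmax : ∫ x, (⨆ i, x i) ∂(hardLaw n K ε) = totalWeight n K / Z := by
    rw [hardLaw, integral_finiteLaw hp, ← sum_seqWeight (K := K) (le_refl n), Finset.sum_div]
    exact Finset.sum_congr rfl fun y _ => hMy y
  have hIcc : ∀ᵐ x ∂(hardLaw n K ε), ∀ i, x i ∈ Set.Icc (0 : ℝ) 1 :=
    ae_finiteLaw _ _ fun y i => ⟨(geomValue_pos hε _).le, geomValue_le_one hε hε1 _⟩
  refine ⟨hardLaw n K ε, isProbabilityMeasure_finiteLaw hp hp1 _, exchangeable_hardLaw n K ε,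
    hIcc, ?_, ?_⟩
  · rw [hmax]; positivity
  intro Ω _ P _ X hX hXν r τ hτ
  have hXm : Measurable fun ω (i : Fin n) => X i ω := measurable_pi_lambda _ hX
  have hsup : Measurable fun x : Fin n → ℝ => ⨆ i, x i :=
    Measurable.iSup fun i => measurable_pi_apply i
  have hXI : ∀ᵐ ω ∂P, ∀ i, X i ω ∈ Set.Icc (0 : ℝ) 1 := by
    rw [← hXν] at hIcc
    exact ae_of_ae_map hXm.aemeasurable hIcc
  have hint : ∀ i, Integrable (X i) P := by
    intro i
    refine Integrable.of_bound (hX i).aestronglyMeasurable 1 ?_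
    filter_upwards [hXI] with ω h
    exact (Real.norm_of_nonneg (h i).1).trans_le (h i).2
  have e1 : ∫ ω, (⨆ i, X i ω) ∂P = totalWeight n K / Z := by
    rw [← hmax, ← hXν, integral_map hXm.aemeasurable hsup.aestronglyMeasurable]
  have e2 : ∫ ω, stopped X τ ω ∂P =
      ∑ y : Fin n → Fin K, hardMass ε y / Z *
        ∑ i, r.stopProb i (fun j => geomValue ε (y j)) * geomValue ε (y i) := by
    have hm : Measurable fun x : Fin n → ℝ => ∑ i, r.stopProb i x * x i :=
      Finset.measurable_sum _ fun i _ => (r.measurable_stopProb i).mul (measurable_pi_apply i)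
    rw [integral_stopped hX hint hτ, ← integral_finiteLaw hp
      (fun (y : Fin n → Fin K) i => geomValue ε (y i)) fun x => ∑ i, r.stopProb i x * x i]
    rw [← hardLaw, ← hXν, integral_map hXm.aemeasurable hm.aestronglyMeasurable]
  set q : Fin n → (Fin n → Fin K) → ℝ := fun i y => r.prob i fun k => geomValue ε (y k) with hqdef
  have hq : ∀ i y, q i y ∈ Set.Icc (0 : ℝ) 1 := fun i y => r.prob_mem i _
  have hd : ∀ i, DependsOn (q i) {j | j ≤ i} := by
    intro i y y' h
    simp only [hqdef]
    congr 1
    funext k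
    rw [h k k.2]
  have hsurv : ∀ (i : Fin n) (y : Fin n → Fin K), r.stopProb i (fun j => geomValue ε (y j)) =
      survival q i y * q i y := by
    intro i y
    rw [StoppingRule.stopProb, survival]
    congr 2
    ext j
    simp
  have hwin := sum_seqWeight_lead_le hn3 hnK hq hd
  rw [e1, e2]
  have hy : ∀ y : Fin n → Fin K, hardMass ε y / Z *
        ∑ i, r.stopProb i (fun j => geomValue ε (y j)) * geomValue ε (y i) ≤
      (seqWeight n y * lead q n y + ε * seqWeight n y) / Z := by
    intro y
    by_cases h0 : seqWeight n y = 0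
    · simp [hardMass, h0]
    have h1 := sum_stop_mul_geomValue_le hε hε1 hq (injective_of_seqWeight_ne_zero h0)
    simp only [hsurv]
    refine (mul_le_mul_of_nonneg_left h1 (hp y)).trans (le_of_eq ?_)
    rw [← mul_assoc, hMy]
    ring
  refine (Finset.sum_le_sum fun y _ => hy y).trans ?_
  rw [← Finset.sum_div, Finset.sum_add_distrib, ← Finset.mul_sum, sum_seqWeight le_rfl,
    ← mul_div_assoc]
  apply div_le_div_of_nonneg_right _ hZ0.le
  have h2 := mul_le_mul_of_nonneg_right hδn hH0.le
  have h3 := mul_le_mul_of_nonneg_right hεδ hH0.le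
  linarith

end HardLaw

/-! ### Counting orders in the secretary problem -/

section Secretary

variable {n : ℕ} {α : Type*} [LinearOrder α]

/-- The indicator of the event that `u j` is the largest of the values `u i`, `i ∈ s`. -/
def isMaxInd (s : Finset (Fin n)) (j : Fin n) (u : Fin n → α) : ℝ :=
  if ∀ i ∈ s, u i ≤ u j then 1 else 0

theorem isMaxInd_nonneg (s : Finset (Fin n)) (j : Fin n) (u : Fin n → α) :
    0 ≤ isMaxInd s j u := by
  unfold isMaxInd; split_ifs <;> norm_num

theorem sum_isMaxInd {s : Finset (Fin n)} (hs : s.Nonempty) {u : Fin n → α}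
    (hu : Function.Injective u) : ∑ j ∈ s, isMaxInd s j u = 1 := by
  obtain ⟨k, hk, hmax⟩ := s.exists_max_image u hs
  rw [Finset.sum_eq_single k]
  · exact if_pos hmax
  · intro j hj hjk
    refine if_neg fun h => hjk (hu (le_antisymm (hmax j hj) (h k hk)))
  · exact fun h => absurd hk h

theorem forall_mem_swap {s : Finset (Fin n)} {j j' : Fin n} (hj : j ∈ s) (hj' : j' ∈ s)
    (Q : Fin n → Prop) : (∀ i ∈ s, Q (Equiv.swap j j' i)) ↔ ∀ i ∈ s, Q i := by
  have hs : ∀ i ∈ s, Equiv.swap j j' i ∈ s := by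
    intro i hi
    rw [Equiv.swap_apply_def]
    split_ifs <;> assumption
  exact ⟨fun h i hi => by simpa using h _ (hs i hi), fun h i hi => h _ (hs i hi)⟩

/-- Swapping two positions inside `s` preserves `s`. Together with reindexing the permutations, this
makes all positions of `s` equally likely to carry its maximum. -/
theorem isMaxInd_comp_mul_swap {s : Finset (Fin n)} {j j' : Fin n} (hj : j ∈ s) (hj' : j' ∈ s)
    (k : Fin n) (u : Fin n → α) (σ : Equiv.Perm (Fin n)) :
    isMaxInd s k (u ∘ ⇑(σ * Equiv.swap j j')) = isMaxInd s (Equiv.swap j j' k) (u ∘ σ) := by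
  unfold isMaxInd
  congr 1
  rw [eq_iff_iff]
  exact forall_mem_swap hj hj' fun i => u (σ i) ≤ u (σ (Equiv.swap j j' k))

theorem sum_perm_isMaxInd_univ {u : Fin n → α} (hu : Function.Injective u) (k : Fin n) :
    n * ∑ σ : Equiv.Perm (Fin n), isMaxInd Finset.univ k (u ∘ σ) = n.factorial := by
  have h1 : ∀ j : Fin n, ∑ σ : Equiv.Perm (Fin n), isMaxInd Finset.univ j (u ∘ σ) =
      ∑ σ : Equiv.Perm (Fin n), isMaxInd Finset.univ k (u ∘ σ) := by
    intro j
    rw [← Equiv.sum_comp (Equiv.mulRight (Equiv.swap j k))]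
    refine Finset.sum_congr rfl fun σ _ => ?_
    rw [Equiv.coe_mulRight]
    beta_reduce
    rw [isMaxInd_comp_mul_swap (Finset.mem_univ _) (Finset.mem_univ _),
      Equiv.swap_apply_left]
  have h2 : ∑ j : Fin n, ∑ σ : Equiv.Perm (Fin n), isMaxInd Finset.univ j (u ∘ σ) =
      n.factorial := by
    rw [Finset.sum_comm]
    have : ∀ σ : Equiv.Perm (Fin n), ∑ j, isMaxInd Finset.univ j (u ∘ σ) = 1 := fun σ =>
      sum_isMaxInd ⟨k, Finset.mem_univ k⟩ (hu.comp σ.injective)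
    simp [this, Fintype.card_perm]
  rw [← h2]
  simp [h1]

/-- Swaps below `k` fix position `k`. So, given that `k` carries the overall maximum, which has
probability `1/n`, the best of the `k` earlier positions is uniformly distributed. -/
theorem sum_perm_isMaxInd_mul {u : Fin n → α} (hu : Function.Injective u) {j k : Fin n}
    (hjk : j < k) : ∑ σ : Equiv.Perm (Fin n),
      isMaxInd Finset.univ k (u ∘ σ) * isMaxInd (Finset.Iio k) j (u ∘ σ) =
      n.factorial * (1 / n * (1 / (k : ℕ))) := by
  have h1 : ∀ i ∈ Finset.Iio k, ∑ σ : Equiv.Perm (Fin n),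
      isMaxInd Finset.univ k (u ∘ σ) * isMaxInd (Finset.Iio k) i (u ∘ σ) =
      ∑ σ : Equiv.Perm (Fin n),
        isMaxInd Finset.univ k (u ∘ σ) * isMaxInd (Finset.Iio k) j (u ∘ σ) := by
    intro i hi
    rw [← Equiv.sum_comp (Equiv.mulRight (Equiv.swap i j))]
    refine Finset.sum_congr rfl fun σ _ => ?_
    rw [Equiv.coe_mulRight]
    beta_reduce
    rw [isMaxInd_comp_mul_swap (Finset.mem_univ _) (Finset.mem_univ _),
      isMaxInd_comp_mul_swap hi (Finset.mem_Iio.2 hjk), Equiv.swap_apply_left,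
      Equiv.swap_apply_of_ne_of_ne (Finset.mem_Iio.1 hi).ne' hjk.ne']
  have h2 : ∑ i ∈ Finset.Iio k, ∑ σ : Equiv.Perm (Fin n),
      isMaxInd Finset.univ k (u ∘ σ) * isMaxInd (Finset.Iio k) i (u ∘ σ) =
      ∑ σ : Equiv.Perm (Fin n), isMaxInd Finset.univ k (u ∘ σ) := by
    rw [Finset.sum_comm]
    refine Finset.sum_congr rfl fun σ _ => ?_
    rw [← Finset.mul_sum, sum_isMaxInd ⟨j, Finset.mem_Iio.2 hjk⟩ (hu.comp σ.injective), mul_one]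
  rw [Finset.sum_congr rfl h1, Finset.sum_const, Fin.card_Iio, nsmul_eq_mul] at h2
  have h3 := sum_perm_isMaxInd_univ hu k
  rw [← h2] at h3
  have hk0 : (0 : ℝ) < (k : ℕ) := by
    exact_mod_cast lt_of_le_of_lt (Nat.zero_le _) (Fin.lt_def.1 hjk)
  have hn0 : (0 : ℝ) < n := hk0.trans (by exact_mod_cast k.2)
  rw [← h3]
  field_simp

/-- Accept the first value of `u` after the first `r` ones that exceeds all the earlier ones. -/
def Accepts (r : ℕ) (u : Fin n → α) (i : Fin n) : Prop := r ≤ (i : ℕ) ∧ ∀ j < i, u j < u i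

theorem accepts_of_isMaxInd {r : ℕ} {u : Fin n → α} (hu : Function.Injective u) {j k : Fin n}
    (hj : (j : ℕ) < r) (hk : r ≤ (k : ℕ)) (hmax : ∀ i, u i ≤ u k) (hlead : ∀ i < k, u i ≤ u j) :
    Accepts r u k ∧ ∀ i < k, ¬ Accepts r u i := by
  refine ⟨⟨hk, fun i hi => (hmax i).lt_of_ne (hu.ne hi.ne)⟩, fun i hi h => ?_⟩
  have hji : j < i := Fin.lt_def.2 (hj.trans_le h.1)
  exact absurd (h.2 j hji) (not_lt.2 (hlead i hi))

end Secretary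

/-! ### The cutoff rule with tie-breaking -/

section CutoffRule

variable {n : ℕ}

/-- The values of `x`, with ties broken by `π`. -/
def lexKey (π : Equiv.Perm (Fin n)) (x : Fin n → ℝ) (i : Fin n) : ℝ ×ₗ Fin n := toLex (x i, π i)

theorem lexKey_injective (π : Equiv.Perm (Fin n)) (x : Fin n → ℝ) :
    Function.Injective (lexKey π x) := by
  intro i j h
  have : (x i, π i) = (x j, π j) := toLex.injective h
  exact π.injective (Prod.ext_iff.1 this).2

theorem le_of_lexKey_le {π : Equiv.Perm (Fin n)} {x : Fin n → ℝ} {i j : Fin n}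
    (h : lexKey π x i ≤ lexKey π x j) : x i ≤ x j := by
  rcases (Prod.Lex.toLex_le_toLex).1 h with h | h
  · exact h.le
  · exact h.1.le

open Classical in
/-- The rule of the secretary problem with cutoff `r`, ties being broken by `π`. -/
noncomputable def cutoffRule (r : ℕ) (π : Equiv.Perm (Fin n)) : StoppingRule n where
  prob i x := if r ≤ (i : ℕ) ∧ ∀ j : Set.Iio i,
    (x ⟨j, Set.Iio_subset_Iic_self j.2⟩ < x ⟨i, Set.self_mem_Iic⟩ ∨
      (x ⟨j, Set.Iio_subset_Iic_self j.2⟩ = x ⟨i, Set.self_mem_Iic⟩ ∧ π j < π i))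
    then 1 else 0
  measurable_prob i := by
    refine Measurable.ite ?_ measurable_const measurable_const
    refine MeasurableSet.inter (MeasurableSet.const _) ?_
    have h : ∀ j : Set.Iio i, MeasurableSet {x : Set.Iic i → ℝ |
        (x ⟨j, Set.Iio_subset_Iic_self j.2⟩ < x ⟨i, Set.self_mem_Iic⟩ ∨
          (x ⟨j, Set.Iio_subset_Iic_self j.2⟩ = x ⟨i, Set.self_mem_Iic⟩ ∧ π j < π i))} := by
      intro j
      refine MeasurableSet.union (measurableSet_lt (measurable_pi_apply _) (measurable_pi_apply _))
        (MeasurableSet.inter (measurableSet_eq_fun (measurable_pi_apply _) (measurable_pi_apply _))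
          (MeasurableSet.const _))
    have := MeasurableSet.iInter h
    rwa [← Set.ofPred_forall] at this
  prob_mem i x := by split_ifs <;> norm_num

open Classical in
theorem cutoffRule_prob (r : ℕ) (π : Equiv.Perm (Fin n)) (i : Fin n) (x : Fin n → ℝ) :
    (cutoffRule r π).prob i (fun k => x k) = if Accepts r (lexKey π x) i then 1 else 0 := by
  simp only [cutoffRule, Accepts, lexKey, Prod.Lex.toLex_lt_toLex]
  congr 1
  simp

open Classical in
theorem cutoffRule_stopProb (r : ℕ) (π : Equiv.Perm (Fin n)) (i : Fin n) (x : Fin n → ℝ) :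
    (cutoffRule r π).stopProb i x =
      if Accepts r (lexKey π x) i ∧ ∀ j < i, ¬ Accepts r (lexKey π x) j then 1 else 0 := by
  rw [StoppingRule.stopProb]
  simp only [cutoffRule_prob]
  by_cases h : ∀ j < i, ¬ Accepts r (lexKey π x) j
  · rw [Finset.prod_eq_one]
    · rw [one_mul]
      congr 1
      rw [eq_iff_iff]
      exact ⟨fun H => ⟨H, h⟩, fun H => H.1⟩
    · intro j hj
      rw [if_neg (h j (Finset.mem_Iio.1 hj)), sub_zero]
  · have h0 : (if Accepts r (lexKey π x) i ∧ ∀ j < i, ¬ Accepts r (lexKey π x) j then (1 : ℝ)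
        else 0) = 0 := if_neg fun H => h H.2
    rw [h0]
    push Not at h
    obtain ⟨j, hj, hA⟩ := h
    rw [Finset.prod_eq_zero (Finset.mem_Iio.2 hj) (by rw [if_pos hA, sub_self]), zero_mul]

/-- The reward of a rule on the sequence `x`, averaged over the randomness of the rule. -/
noncomputable def StoppingRule.reward (r : StoppingRule n) (x : Fin n → ℝ) : ℝ :=
  ∑ i, r.stopProb i x * x i

theorem StoppingRule.measurable_reward (r : StoppingRule n) : Measurable r.reward :=
  Finset.measurable_sum _ fun i _ => (r.measurable_stopProb i).mul (measurable_pi_apply i)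

/-- If `k` carries the maximum and the best earlier key lies before the cutoff, nothing between them
is accepted and the rule stops at `k`. Keys are distinct, so at most one `j` contributes. -/
theorem sum_isMaxInd_mul_le_stopProb_mul {r : ℕ} {π : Equiv.Perm (Fin n)}
    {x : Fin n → ℝ} (hx : ∀ i, 0 ≤ x i) {k : Fin n} (hk : r ≤ (k : ℕ)) :
    (∑ j ∈ Finset.univ.filter (fun j : Fin n => (j : ℕ) < r),
      isMaxInd Finset.univ k (lexKey π x) * isMaxInd (Finset.Iio k) j (lexKey π x)) *
        (⨆ i, x i) ≤ (cutoffRule r π).stopProb k x * x k := by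
  classical
  have hR : 0 ≤ (cutoffRule r π).stopProb k x * x k :=
    mul_nonneg ((cutoffRule r π).stopProb_mem k x).1 (hx k)
  have hu := lexKey_injective π x
  by_cases H : ∃ j : Fin n, (j : ℕ) < r ∧ (∀ i, lexKey π x i ≤ lexKey π x k) ∧
      ∀ i < k, lexKey π x i ≤ lexKey π x j
  · obtain ⟨j, hj, hmax, hlead⟩ := H
    have hjk : j < k := Fin.lt_def.2 (hj.trans_le hk)
    rw [cutoffRule_stopProb, if_pos (accepts_of_isMaxInd hu hj hk hmax hlead), one_mul]
    have hM : ⨆ i, x i = x k := by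
      have : Nonempty (Fin n) := ⟨k⟩
      exact le_antisymm (ciSup_le fun i => le_of_lexKey_le (hmax i)) (le_iSup_fin x k)
    rw [hM]
    apply mul_le_of_le_one_left (hx k)
    rw [← sum_isMaxInd (s := Finset.Iio k) ⟨j, Finset.mem_Iio.2 hjk⟩ hu, ← Finset.mul_sum]
    have h1 : isMaxInd Finset.univ k (lexKey π x) = 1 := if_pos fun i _ => hmax i
    rw [h1, one_mul]
    refine Finset.sum_le_sum_of_subset_of_nonneg (fun i hi => ?_) fun i _ _ => isMaxInd_nonneg _ _ _
    exact Finset.mem_Iio.2 (Fin.lt_def.2 ((Finset.mem_filter.1 hi).2.trans_le hk))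
  · rw [Finset.sum_eq_zero, zero_mul]
    · exact hR
    · intro j hj
      unfold isMaxInd
      split_ifs with h1 h2
      · exact absurd ⟨j, (Finset.mem_filter.1 hj).2, fun i => h1 i (Finset.mem_univ i),
          fun i hi => h2 i (Finset.mem_Iio.2 hi)⟩ H
      all_goals norm_num

/-- Permuting the tie-breaker along with the sequence makes the keys of `x ∘ σ` those of `x`
permuted by `σ`. Hence the count for distinct values applies even when `x` has ties. -/
theorem le_sum_perm_reward {r : ℕ} (hrn : r < n) (ρ : Equiv.Perm (Fin n))
    {x : Fin n → ℝ} (hx : ∀ i, 0 ≤ x i) :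
    n.factorial * ((r / n : ℝ) * harmonicTail n r) * (⨆ i, x i) ≤
      ∑ σ : Equiv.Perm (Fin n), (cutoffRule r (ρ * σ)).reward (x ∘ σ) := by
  have hsup : ∀ σ : Equiv.Perm (Fin n), ⨆ i, (x ∘ σ) i = ⨆ i, x i := fun σ =>
    σ.iSup_comp (g := x)
  have h1 : ∀ σ : Equiv.Perm (Fin n),
      (∑ k ∈ Finset.univ.filter (fun k : Fin n => r ≤ (k : ℕ)),
        ∑ j ∈ Finset.univ.filter (fun j : Fin n => (j : ℕ) < r),
          isMaxInd Finset.univ k (lexKey ρ x ∘ σ) * isMaxInd (Finset.Iio k) j (lexKey ρ x ∘ σ)) *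
        (⨆ i, x i) ≤ (cutoffRule r (ρ * σ)).reward (x ∘ σ) := by
    intro σ
    rw [Finset.sum_mul, StoppingRule.reward]
    refine (Finset.sum_le_sum fun k hk => ?_).trans
      (Finset.sum_le_sum_of_subset_of_nonneg (Finset.filter_subset _ _) fun k _ _ =>
        mul_nonneg (StoppingRule.stopProb_mem _ k _).1 (hx _))
    rw [← hsup σ]
    exact sum_isMaxInd_mul_le_stopProb_mul (π := ρ * σ) (x := x ∘ σ) (fun i => hx (σ i))
      (Finset.mem_filter.1 hk).2
  refine le_trans (le_of_eq ?_) (Finset.sum_le_sum fun σ _ => h1 σ)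
  rw [← Finset.sum_mul]
  congr 1
  rw [Finset.sum_comm]
  have h2 : ∀ k ∈ Finset.univ.filter (fun k : Fin n => r ≤ (k : ℕ)),
      ∑ σ : Equiv.Perm (Fin n), ∑ j ∈ Finset.univ.filter (fun j : Fin n => (j : ℕ) < r),
          isMaxInd Finset.univ k (lexKey ρ x ∘ σ) * isMaxInd (Finset.Iio k) j (lexKey ρ x ∘ σ) =
      n.factorial * (r / n) * (1 / (k : ℕ)) := by
    intro k hk
    rw [Finset.sum_comm, Finset.sum_congr rfl fun j hj => sum_perm_isMaxInd_mul
      (lexKey_injective ρ x) (Fin.lt_def.2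
        ((Finset.mem_filter.1 hj).2.trans_le (Finset.mem_filter.1 hk).2)),
      Finset.sum_const, Fin.card_filter_val_lt, min_eq_right hrn.le, nsmul_eq_mul]
    ring
  rw [Finset.sum_congr rfl h2, ← Finset.mul_sum, ← mul_assoc]
  congr 1
  rw [harmonicTail, Finset.sum_filter, Fin.sum_univ_eq_sum_range
    (fun k : ℕ => if r ≤ k then 1 / (k : ℝ) else 0), ← Finset.sum_filter]
  refine Finset.sum_congr ?_ fun _ _ => rfl
  ext k
  simp only [Finset.mem_Ico, Finset.mem_filter, Finset.mem_range]
  omega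

end CutoffRule

/-! ### The guarantee `1/e` and its optimality -/

section Lower

variable {n : ℕ}

theorem min_filter_eq_coe_iff (d : Fin n → Prop) [DecidablePred d] (i : Fin n) :
    (Finset.univ.filter d).min = (i : WithTop (Fin n)) ↔ d i ∧ ∀ j < i, ¬ d j := by
  constructor
  · intro h
    refine ⟨(Finset.mem_filter.1 (Finset.mem_of_min h)).2, fun j hj hd => ?_⟩
    exact absurd (Finset.min_le_of_eq (Finset.mem_filter.2 ⟨Finset.mem_univ j, hd⟩) h)
      (not_le.2 hj)
  · rintro ⟨hd, hlt⟩
    apply le_antisymm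
    · exact Finset.min_le (Finset.mem_filter.2 ⟨Finset.mem_univ i, hd⟩)
    · refine Finset.le_min fun j hj => WithTop.coe_le_coe.2 (not_lt.1 fun h => ?_)
      exact hlt j h (Finset.mem_filter.1 hj).2

open Classical in
/-- The stopping time of the cutoff rule. -/
noncomputable def cutoffTime {Ω : Type u} (r : ℕ) (π : Equiv.Perm (Fin n)) (X : Fin n → Ω → ℝ)
    (ω : Ω) : WithTop (Fin n) :=
  (Finset.univ.filter fun i => Accepts r (lexKey π fun j => X j ω) i).min

theorem isStoppingTimeOf_cutoffTime {Ω : Type u} [MeasurableSpace Ω] (P : Measure Ω)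
    [IsProbabilityMeasure P] {X : Fin n → Ω → ℝ} (hX : ∀ i, Measurable (X i)) (r : ℕ)
    (π : Equiv.Perm (Fin n)) :
    IsStoppingTimeOf (cutoffRule r π) X (cutoffTime r π X) P := by
  classical
  intro i
  have hXm : Measurable fun ω (j : Fin n) => X j ω := measurable_pi_lambda _ hX
  set A : Set (Fin n → ℝ) := {x | (cutoffRule r π).stopProb i x = 1} with hA
  have hAm : MeasurableSet A :=
    (cutoffRule r π).measurable_stopProb i (measurableSet_singleton 1)
  have hS : {ω | cutoffTime r π X ω = (i : WithTop (Fin n))} =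
      (fun ω (j : Fin n) => X j ω) ⁻¹' A := by
    ext ω
    rw [Set.mem_preimage, hA, Set.mem_ofPred_eq, Set.mem_ofPred_eq, cutoffTime,
      min_filter_eq_coe_iff, cutoffRule_stopProb]
    split_ifs with h
    · exact ⟨fun _ => rfl, fun _ => h⟩
    · exact ⟨fun H => absurd H h, fun H => absurd H zero_ne_one⟩
  have hSm := hXm hAm
  rw [← hS] at hSm
  refine ⟨hSm, ?_⟩
  -- The rule is deterministic: the event is determined by the sequence, so conditioning changes
  -- nothing.
  rw [condExp_of_stronglyMeasurable hXm.comap_le]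
  · refine Filter.Eventually.of_forall fun ω => ?_
    simp only [cutoffRule_stopProb]
    have hiff : ω ∈ {ω | cutoffTime r π X ω = (i : WithTop (Fin n))} ↔
        Accepts r (lexKey π fun j => X j ω) i ∧
          ∀ j < i, ¬ Accepts r (lexKey π fun j => X j ω) j :=
      min_filter_eq_coe_iff (fun i => Accepts r (lexKey π fun j => X j ω) i) i
    split_ifs with h
    · exact Set.indicator_of_mem (hiff.2 h) _
    · exact Set.indicator_of_notMem (fun H => h (hiff.1 H)) _
  · rw [hS]
    exact stronglyMeasurable_const.indicator ⟨A, hAm, rfl⟩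
  · exact (integrable_const 1).indicator hSm

theorem integrable_iSup {Ω : Type*} [MeasurableSpace Ω] {P : Measure Ω}
    {X : Fin n → Ω → ℝ} (hX : ∀ i, Measurable (X i)) (hint : ∀ i, Integrable (X i) P) :
    Integrable (fun ω => ⨆ i, X i ω) P := by
  refine Integrable.mono' (integrable_finsetSum Finset.univ fun i _ => (hint i).abs)
    (Measurable.iSup hX).aestronglyMeasurable (Filter.Eventually.of_forall fun ω => ?_)
  rcases isEmpty_or_nonempty (Fin n) with h | h
  · simp [Real.iSup_of_isEmpty]
  · obtain ⟨i, hi⟩ := exists_eq_ciSup_of_finite (f := fun i => X i ω)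
    rw [← hi]
    exact Finset.single_le_sum (f := fun i => |X i ω|) (fun _ _ => abs_nonneg _)
      (Finset.mem_univ i)

theorem StoppingRule.integrable_reward {Ω : Type*} [MeasurableSpace Ω] {P : Measure Ω}
    {X : Fin n → Ω → ℝ} (hX : ∀ i, Measurable (X i)) (hint : ∀ i, Integrable (X i) P)
    (r : StoppingRule n) : Integrable (fun ω => r.reward fun j => X j ω) P :=
  integrable_finsetSum _ fun i _ => integrable_stopProb_mul hX hint r i

theorem Exchangeable.integral_reward_comp {Ω : Type u} [MeasurableSpace Ω] {P : Measure Ω}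
    {X : Fin n → Ω → ℝ} (hX : ∀ i, Measurable (X i)) (h : Exchangeable X P)
    (r : StoppingRule n) (σ : Equiv.Perm (Fin n)) :
    ∫ ω, r.reward (fun j => X (σ j) ω) ∂P = ∫ ω, r.reward (fun j => X j ω) ∂P := by
  have h1 := integral_map (μ := P) (φ := fun ω (i : Fin n) => X (σ i) ω) (f := r.reward)
    (measurable_pi_lambda _ fun i => hX (σ i)).aemeasurable
    r.measurable_reward.aestronglyMeasurable
  have h2 := integral_map (μ := P) (φ := fun ω (i : Fin n) => X i ω) (f := r.reward)
    (measurable_pi_lambda _ hX).aemeasurable r.measurable_reward.aestronglyMeasurable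
  rw [← h1, ← h2, h σ]

/-- By exchangeability, permuting the sequence does not change the expected reward of a fixed rule.
So `le_sum_perm_reward` bounds the average over all `n!` tie-breakers, and one of them attains at
least the average. -/
theorem exists_cutoffRule_reward {Ω : Type u} [MeasurableSpace Ω] {P : Measure Ω}
    {X : Fin n → Ω → ℝ} (hX : ∀ i, Measurable (X i))
    (hint : ∀ i, Integrable (X i) P) (h0 : ∀ᵐ ω ∂P, ∀ i, 0 ≤ X i ω) (hex : Exchangeable X P)
    {r : ℕ} (hr : r < n) : ∃ π : Equiv.Perm (Fin n),
      ((r / n : ℝ) * harmonicTail n r) * ∫ ω, (⨆ i, X i ω) ∂P ≤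
        ∫ ω, (cutoffRule r π).reward (fun j => X j ω) ∂P := by
  set c : ℝ := (r / n : ℝ) * harmonicTail n r with hc
  have hf : (0 : ℝ) < n.factorial := by exact_mod_cast n.factorial_pos
  have h1 : ∀ ρ : Equiv.Perm (Fin n), n.factorial * c * ∫ ω, (⨆ i, X i ω) ∂P ≤
      ∑ σ : Equiv.Perm (Fin n), ∫ ω, (cutoffRule r (ρ * σ)).reward (fun j => X j ω) ∂P := by
    intro ρ
    have hi : ∀ σ : Equiv.Perm (Fin n),
        Integrable (fun ω => (cutoffRule r (ρ * σ)).reward fun j => X (σ j) ω) P := fun σ =>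
      StoppingRule.integrable_reward (fun i => hX (σ i)) (fun i => hint (σ i)) _
    have e : ∑ σ : Equiv.Perm (Fin n), ∫ ω, (cutoffRule r (ρ * σ)).reward (fun j => X j ω) ∂P =
        ∫ ω, ∑ σ : Equiv.Perm (Fin n), (cutoffRule r (ρ * σ)).reward (fun j => X (σ j) ω) ∂P := by
      rw [integral_finsetSum _ fun σ _ => hi σ]
      exact Finset.sum_congr rfl fun σ _ => (hex.integral_reward_comp hX _ σ).symm
    rw [e, ← integral_const_mul]
    refine integral_mono_ae ((integrable_iSup hX hint).const_mul _)
      (integrable_finsetSum _ fun σ _ => hi σ) ?_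
    filter_upwards [h0] with ω hω
    exact le_sum_perm_reward hr ρ hω
  have h2 : ∀ ρ : Equiv.Perm (Fin n), ∑ σ : Equiv.Perm (Fin n),
      ∫ ω, (cutoffRule r (ρ * σ)).reward (fun j => X j ω) ∂P =
      ∑ π : Equiv.Perm (Fin n), ∫ ω, (cutoffRule r π).reward (fun j => X j ω) ∂P := fun ρ =>
    Equiv.sum_comp (Equiv.mulLeft ρ)
      fun π => ∫ ω, (cutoffRule r π).reward (fun j => X j ω) ∂P
  have h3 := h1 1
  rw [h2] at h3
  obtain ⟨π, -, hπ⟩ := Finset.exists_le_of_sum_le (s := (Finset.univ : Finset (Equiv.Perm (Fin n))))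
    (f := fun _ => c * ∫ ω, (⨆ i, X i ω) ∂P)
    (g := fun π => ∫ ω, (cutoffRule r π).reward (fun j => X j ω) ∂P) ⟨1, Finset.mem_univ 1⟩ (by
      rw [Finset.sum_const, Finset.card_univ, Fintype.card_perm, Fintype.card_fin, nsmul_eq_mul]
      linarith)
  exact ⟨π, hπ⟩

theorem isUniversalConstant_one_div_exp :
    IsUniversalConstant.{u} (Set.Ici (0 : ℝ)) (1 / Real.exp 1) := by
  intro n hn Ω _ P _ X hX hint h0 hex
  have hpos : 0 ≤ ∫ ω, (⨆ i, X i ω) ∂P := by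
    refine integral_nonneg_of_ae ?_
    filter_upwards [h0] with ω hω
    exact Real.iSup_nonneg hω
  suffices h : ∃ (r : ℕ) (π : Equiv.Perm (Fin n)), 1 / Real.exp 1 * ∫ ω, (⨆ i, X i ω) ∂P ≤
      ∫ ω, (cutoffRule r π).reward (fun j => X j ω) ∂P by
    obtain ⟨r, π, h⟩ := h
    have hτ := isStoppingTimeOf_cutoffTime P hX r π
    exact ⟨cutoffRule r π, cutoffTime r π X, hτ, h.trans (integral_stopped hX hint hτ).ge⟩
  rcases hn.eq_or_lt with rfl | hn
  -- For a single variable, cutoff 0 accepts it vacuously and the reward is the maximum.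
  · refine ⟨0, 1, ?_⟩
    have h1 : ∀ ω, (cutoffRule 0 (1 : Equiv.Perm (Fin 1))).reward (fun j => X j ω) =
        ⨆ i, X i ω := by
      intro ω
      simp [StoppingRule.reward, cutoffRule_stopProb, Accepts]
    simp only [h1]
    apply mul_le_of_le_one_left hpos
    rw [div_le_one (Real.exp_pos 1)]
    exact Real.one_le_exp zero_le_one
  · obtain ⟨r, -, hr, hle⟩ := exists_cutoff hn
    obtain ⟨π, hπ⟩ := exists_cutoffRule_reward hX hint h0 hex hr
    exact ⟨r, π, (mul_le_mul_of_nonneg_right hle hpos).trans hπ⟩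

theorem IsUniversalConstant.mono {S T : Set ℝ} (hST : S ⊆ T) {γ : ℝ}
    (h : IsUniversalConstant.{u} T γ) : IsUniversalConstant.{u} S γ :=
  fun n hn Ω _ P _ X hX hint hS hex =>
    h n hn Ω P X hX hint (hS.mono fun _ hω i => hST (hω i)) hex

theorem IsUniversalConstant.le_one_div_exp {γ : ℝ}
    (h : IsUniversalConstant.{u} (Set.Icc (0 : ℝ) 1) γ) : γ ≤ 1 / Real.exp 1 := by
  by_contra hγ
  push Not at hγ
  obtain ⟨n₀, hn₀⟩ := exists_hard_law.{u} (half_pos (sub_pos.2 hγ))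
  obtain ⟨ν, hν, hex, hIcc, hpos, hub⟩ := hn₀ (max n₀ 1) (le_max_left _ _)
  -- The hard law lives on a space in universe 0, so it is transported to universe `u`.
  have hup : Measurable (ULift.up.{u} : (Fin (max n₀ 1) → ℝ) → _) := measurable_up
  set P := ν.map (ULift.up.{u} : (Fin (max n₀ 1) → ℝ) → _) with hP
  have : IsProbabilityMeasure P := Measure.isProbabilityMeasure_map hup.aemeasurable
  set X : Fin (max n₀ 1) → ULift.{u} (Fin (max n₀ 1) → ℝ) → ℝ := fun i ω => ω.down i with hXdef
  have hX : ∀ i, Measurable (X i) := fun i => (measurable_pi_apply i).comp measurable_down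
  have hmap : ∀ σ : Equiv.Perm (Fin (max n₀ 1)),
      P.map (fun ω i => X (σ i) ω) = ν.map fun x i => x (σ i) := by
    intro σ
    rw [hP, Measure.map_map (measurable_pi_lambda _ fun i => hX (σ i)) hup]
    rfl
  have hmap1 : P.map (fun ω i => X i ω) = ν := (hmap 1).trans Measure.map_id
  have hXI : ∀ᵐ ω ∂P, ∀ i, X i ω ∈ Set.Icc (0 : ℝ) 1 := by
    rw [← hmap1] at hIcc
    exact ae_of_ae_map (measurable_pi_lambda _ hX).aemeasurable hIcc
  have hint : ∀ i, Integrable (X i) P := by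
    intro i
    refine Integrable.of_bound (hX i).aestronglyMeasurable 1 ?_
    filter_upwards [hXI] with ω h
    exact (Real.norm_of_nonneg (h i).1).trans_le (h i).2
  have hexX : Exchangeable X P := fun σ => by
    rw [hmap σ, hex σ]
    exact (hmap 1).symm
  obtain ⟨r, τ, hτ, hle⟩ := h _ (le_max_right _ _) _ P X hX hint hXI hexX
  have h1 := hub _ P X hX hmap1 r τ hτ
  have h2 : ∫ ω, (⨆ i, X i ω) ∂P = ∫ x, (⨆ i, x i) ∂ν := by
    have hs : Measurable fun x : Fin (max n₀ 1) → ℝ => ⨆ i, x i :=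
      Measurable.iSup fun i => measurable_pi_apply i
    have := integral_map (μ := P) (measurable_pi_lambda _ hX).aemeasurable
      hs.aestronglyMeasurable
    rw [hmap1] at this
    exact this.symm
  rw [← h2] at hpos
  have h3 := le_of_mul_le_mul_right (hle.trans h1) hpos
  linarith

end Lower

end Prophet

/-- Part one: hard exchangeable laws `ν`, which are not degenerate (`E[max] > 0`); the bound holds
for every realization `X` of `ν`, on a probability space that may carry extra randomness for the
stopping time. Parts two and three: the largest universal constant is `1/e`, for values in `[0,1]`
and for non-negative values. -/
theorem mainTheorem2 :
    (∀ δ : ℝ, 0 < δ → ∃ n₀ : ℕ, ∀ n : ℕ, n₀ ≤ n →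
      ∃ ν : Measure (Fin n → ℝ), IsProbabilityMeasure ν ∧
        Prophet.Exchangeable (fun (i : Fin n) (x : Fin n → ℝ) => x i) ν ∧
        (∀ᵐ x ∂ν, ∀ i, x i ∈ Set.Icc (0 : ℝ) 1) ∧
        0 < ∫ x, (⨆ i, x i) ∂ν ∧
        ∀ (Ω : Type u) [MeasurableSpace Ω] (P : Measure Ω) [IsProbabilityMeasure P]
          (X : Fin n → Ω → ℝ), (∀ i, Measurable (X i)) →
          P.map (fun ω (i : Fin n) => X i ω) = ν →
          ∀ (r : Prophet.StoppingRule n) (τ : Ω → WithTop (Fin n)),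
            Prophet.IsStoppingTimeOf r X τ P →
            ∫ ω, Prophet.stopped X τ ω ∂P
              ≤ (1 / Real.exp 1 + δ) * ∫ ω, (⨆ i, X i ω) ∂P) ∧
    IsGreatest {γ : ℝ | Prophet.IsUniversalConstant.{u} (Set.Icc (0 : ℝ) 1) γ}
      (1 / Real.exp 1) ∧
    IsGreatest {γ : ℝ | Prophet.IsUniversalConstant.{u} (Set.Ici (0 : ℝ)) γ}
      (1 / Real.exp 1) := by
  have hsub : Set.Icc (0 : ℝ) 1 ⊆ Set.Ici 0 := fun _ h => h.1
  exact ⟨fun δ hδ => Prophet.exists_hard_law hδ,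
    ⟨Prophet.isUniversalConstant_one_div_exp.mono hsub, fun _ h => h.le_one_div_exp⟩,
    ⟨Prophet.isUniversalConstant_one_div_exp, fun _ h => (h.mono hsub).le_one_div_exp⟩⟩
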